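/- Let $K\in BC^1(\mathbf{R}^2)$ be real-valued (that is, $K$ is continuously differentiable, and $K$ and its first partial derivatives are bounded), and assume that (K-1) there is $k_m>0$ with $K(x)\ge k_m$ for all $x\in\mathbf{R}^2$; (K-2) $x\cdot\nabla K(x)\le 0$ for all $x\in\mathbf{R}^2$; (K-3) there are $r_0>0$ and a constant $k_0$ with $K(x)=k_0$ for all $x$ with $|x|>r_0$. Let $u_0,u_1\in C_0^\infty(\mathbf{R}^2)$ be real-valued, and let $u$ be the solution of the Cauchy problem $$u_{tt}-\nabla\cdot(K(x)\nabla u)=0\quad\text{in }(0,\infty)\times\mathbf{R}^2,\qquad u(0,\cdot)=u_0,\quad u_t(0,\cdot)=u_1,$$ in the class $C([0,\infty);H^1(\mathbf{R}^2))\cap C^1([0,\infty);L^2(\mathbf{R}^2))$, where the equation is understood in the weak sense: for every $\varphi\in C_0^\infty(\mathbf{R}^2)$ and every $t>0$, $$\frac{d}{dt}\int_{\mathbf{R}^2}u_t(t,x)\varphi(x)\,dx=-\int_{\mathbf{R}^2}K(x)\nabla u(t,x)\cdot\nabla\varphi(x)\,dx .$$ Then for every $R>r_0$ the local energy $$E_{u,R}(t)=\frac12\int_{|x|\le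 R}\bigl(|u_t(t,x)|^2+K(x)|\nabla u(t,x)|^2\bigr)\,dx$$ satisfies $$E_{u,R}(t)=O\bigl(t^{-1}\sqrt{\log t}\bigr)\qquad(t\to\infty).$$ -/

import Mathlib

open MeasureTheory Filter Asymptotics
open scoped ContDiff Topology

/-- The Euclidean plane. -/
abbrev Plane : Type := EuclideanSpace ℝ (Fin 2)

/-- The class `C₀^∞(ℝ²)` of real-valued test functions. -/
def IsTestFunction (φ : Plane → ℝ) : Prop :=
  ContDiff ℝ ∞ φ ∧ HasCompactSupport φ

/-- The class `BC¹(ℝ²)`: continuously differentiable, bounded, with bounded first derivatives. -/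
def IsBC1 (K : Plane → ℝ) : Prop :=
  ContDiff ℝ 1 K ∧ (∃ C : ℝ, ∀ x, |K x| ≤ C) ∧ ∃ C : ℝ, ∀ x, ‖gradient K x‖ ≤ C

/-- `g` is the weak (distributional) gradient of `f`. For `f ∈ L²` and `g ∈ L²` this says that
`f ∈ H¹(ℝ²)` and `∇f = g`. -/
def HasWeakGradient (f : Plane → ℝ) (g : Plane → Plane) : Prop :=
  ∀ φ : Plane → ℝ, IsTestFunction φ →
    ∫ x, f x • gradient φ x = -∫ x, φ x • g x

/-- `u` is a (finite energy, weak) solution on `[0, ∞)` of the Cauchy problem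
`u_tt - ∇ ⬝ (K ∇u) = 0`, `u(0) = u₀`, `u_t(0) = u₁`, with time derivative `ut` and spatial
gradient `gradu`. The solution class is `C([0, ∞); H¹(ℝ²)) ∩ C¹([0, ∞); L²(ℝ²))`. Both `ut` and
`gradu` are determined by `u`. Values at negative times play no role. -/
structure IsWaveSolution (K u₀ u₁ : Plane → ℝ)
    (u ut : ℝ → Lp ℝ 2 (volume : Measure Plane))
    (gradu : ℝ → Lp Plane 2 (volume : Measure Plane)) : Prop where
  /-- `gradu t` is the spatial gradient of `u t`; in particular `u t ∈ H¹`. -/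
  weakGradient : ∀ t : ℝ, 0 ≤ t → HasWeakGradient (u t) (gradu t)
  /-- With the continuity of `u` in `L²`, this says `u ∈ C([0, ∞); H¹)`. -/
  continuousOn_gradu : ContinuousOn gradu (Set.Ici 0)
  /-- `ut` is the derivative of `u` in `L²`. -/
  hasDeriv : ∀ t : ℝ, 0 ≤ t → HasDerivWithinAt u (ut t) (Set.Ici 0) t
  /-- With the previous clause, this says `u ∈ C¹([0, ∞); L²)`. -/
  continuousOn_ut : ContinuousOn ut (Set.Ici 0)
  /-- The equation `u_tt = ∇ ⬝ (K ∇u)` for `t > 0`, tested against functions of `x`. -/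
  equation : ∀ φ : Plane → ℝ, IsTestFunction φ → ∀ t : ℝ, 0 < t →
    HasDerivAt (fun s => ∫ x, ut s x * φ x)
      (-∫ x, K x * inner ℝ (gradu t x) (gradient φ x)) t
  /-- Initial position. -/
  init_pos : u 0 =ᵐ[volume] u₀
  /-- Initial velocity. -/
  init_vel : ut 0 =ᵐ[volume] u₁

/-- The local energy `½ ∫_{|x| ≤ R} (|v|² + K |w|²) dx` of a state with velocity `v` and
spatial gradient `w`. -/
noncomputable def localEnergy (K : Plane → ℝ) (R : ℝ) (v : Plane → ℝ) (w : Plane → Plane) : ℝ :=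
  (1 / 2) * ∫ x in Metric.closedBall (0 : Plane) R, (|v x| ^ 2 + K x * ‖w x‖ ^ 2)

/-! The proof is Morawetz's multiplier method with `t u_t + x · ∇u + u / 2`. Multiplying the
equation by it and integrating shows that `t E(t) + ∫ u_t x · ∇u + (1/2) ∫ u u_t` does not increase,
where `E` is the total energy: in dimension two all terms cancel except `∫ u_tt x · ∇u`-type
Pohozaev terms, whose sign comes from `x · ∇K ≤ 0`.

This controls the local energy for two reasons. By finite propagation the solution lives in `|x| ≤ ρ
+ c t` with `c = √k₀`. Outside the ball of radius `R` one has `K = c²`, so `|u_t x · ∇u|` is at most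
`(t + ρ / c)` times the energy density and is absorbed by `t E` up to a bounded multiple of the
energy. Inside that ball it costs only `R / √km` times the local energy. Hence `(t - R / √km)
E_R(t)` is at most a constant plus `(1/2) ‖u‖ ‖u_t‖` (`localEnergy_le`, `IsMildSolution.morawetz`).

It remains to bound `‖u(t)‖` by a multiple of `√log t`. The time primitive `v = ∫₀ᵗ u` solves `v_tt
- ∇ · (K ∇v) = u₁`, so its energy, which contains `‖u‖²`, is controlled by `∫ u₁ v`. A Hardy
inequality on the ball of radius `ρ + c t`, with a constant growing like `log t`, bounds this
pairing by `‖∇v‖` (`HasWeakGradient.hardy`, `IsMildSolution.norm_sq_le`).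

The computations need more regularity than the solution has. Steklov averages in time turn it into
`C²` in time with velocity in `H¹`, and the estimates pass to the limit. No second space derivatives
are used: the Pohozaev inequality is obtained by comparing a function with its dilations
(`IsWeakDivergence.inner_radial_nonpos`). -/

/-- Square integrable functions on the plane. -/
abbrev L2 (E : Type) [NormedAddCommGroup E] : Type := Lp E 2 (volume : Measure Plane)

/-! ### Multiplication operators on `L²`. -/

section Operators

variable {E F : Type} [NormedAddCommGroup E] [NormedSpace ℝ E] [NormedAddCommGroup F]
  [NormedSpace ℝ F]

open Classical in
/-- The operator on `L²` given by pointwise application of an essentially bounded operator field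
(zero if the field is not essentially bounded). -/
noncomputable def mulOp (L : Plane → E →L[ℝ] F) : L2 E →L[ℝ] L2 F :=
  if h : MemLp L ⊤ (volume : Measure Plane) then
    (ContinuousLinearMap.holderL (volume : Measure Plane) ⊤ 2 2
      (ContinuousLinearMap.id ℝ (E →L[ℝ] F))) (h.toLp L)
  else 0

theorem coeFn_mulOp {L : Plane → E →L[ℝ] F} (h : MemLp L ⊤ (volume : Measure Plane)) (f : L2 E) :
    mulOp L f =ᵐ[volume] fun x => L x (f x) := by
  rw [mulOp, dif_pos h, ContinuousLinearMap.holderL_apply_apply]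
  filter_upwards [ContinuousLinearMap.coeFn_holder (r := 2) (μ := (volume : Measure Plane))
    (ContinuousLinearMap.id ℝ (E →L[ℝ] F)) (h.toLp L) f, h.coeFn_toLp] with x hx hx'
  rw [hx, hx']
  rfl

/-- Multiplication by a scalar function. -/
noncomputable def scal (E : Type) [NormedAddCommGroup E] [NormedSpace ℝ E] (m : Plane → ℝ) :
    L2 E →L[ℝ] L2 E :=
  mulOp fun x => m x • ContinuousLinearMap.id ℝ E

/-- Pointwise inner product with a vector field. -/
noncomputable def dot (X : Plane → Plane) : L2 Plane →L[ℝ] L2 ℝ :=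
  mulOp fun x => innerSL ℝ (X x)

/-- Multiplication of a scalar function by a vector field. -/
noncomputable def vec (X : Plane → Plane) : L2 ℝ →L[ℝ] L2 Plane :=
  mulOp fun x => (ContinuousLinearMap.id ℝ ℝ).smulRight (X x)

theorem coeFn_scal {m : Plane → ℝ} (h : MemLp m ⊤ (volume : Measure Plane)) (f : L2 E) :
    scal E m f =ᵐ[volume] fun x => m x • f x := by
  refine coeFn_mulOp (L := fun x => m x • ContinuousLinearMap.id ℝ E) ?_ f
  exact (((ContinuousLinearMap.id ℝ ℝ).smulRight (ContinuousLinearMap.id ℝ E)).comp_memLp' h)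

theorem coeFn_dot {X : Plane → Plane} (h : MemLp X ⊤ (volume : Measure Plane)) (f : L2 Plane) :
    dot X f =ᵐ[volume] fun x => inner ℝ (X x) (f x) := by
  refine coeFn_mulOp (L := fun x => innerSL ℝ (X x)) ?_ f
  exact (innerSL ℝ (E := Plane)).comp_memLp' h

theorem coeFn_vec {X : Plane → Plane} (h : MemLp X ⊤ (volume : Measure Plane)) (f : L2 ℝ) :
    vec X f =ᵐ[volume] fun x => f x • X x := by
  refine coeFn_mulOp (L := fun x => (ContinuousLinearMap.id ℝ ℝ).smulRight (X x)) ?_ f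
  exact (ContinuousLinearMap.smulRightL ℝ ℝ Plane (ContinuousLinearMap.id ℝ ℝ)).comp_memLp' h

end Operators

theorem memLp_top_of_continuous {E : Type} [NormedAddCommGroup E] [SecondCountableTopology E]
    {m : Plane → E} (hm : Continuous m) {C : ℝ} (hC : ∀ x, ‖m x‖ ≤ C) :
    MemLp m ⊤ (volume : Measure Plane) :=
  memLp_top_of_bound hm.aestronglyMeasurable C (Eventually.of_forall hC)

theorem MeasureTheory.MemLp.integrable_smul {E : Type} [NormedAddCommGroup E] [NormedSpace ℝ E]
    {f : Plane → ℝ} {g : Plane → E} (hf : MemLp f 2 (volume : Measure Plane))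
    (hg : MemLp g 2 (volume : Measure Plane)) : Integrable fun x => f x • g x :=
  memLp_one_iff_integrable.1 (hg.smul hf)

theorem inner_L2 {E : Type} [NormedAddCommGroup E] [InnerProductSpace ℝ E] (f g : L2 E) :
    inner ℝ f g = ∫ x, inner ℝ (f x) (g x) := L2.inner_def f g

theorem integrable_inner_L2 {E : Type} [NormedAddCommGroup E] [InnerProductSpace ℝ E]
    (f g : L2 E) : Integrable (fun x => inner ℝ (f x) (g x)) := L2.integrable_inner f g

theorem norm_sq_L2 {E : Type} [NormedAddCommGroup E] [InnerProductSpace ℝ E] (f : L2 E) :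
    ‖f‖ ^ 2 = ∫ x, ‖f x‖ ^ 2 := by
  rw [← real_inner_self_eq_norm_sq, inner_L2]
  simp_rw [real_inner_self_eq_norm_sq]

theorem integrable_norm_sq_L2 {E : Type} [NormedAddCommGroup E] [InnerProductSpace ℝ E]
    (f : L2 E) : Integrable (fun x => ‖f x‖ ^ 2) := by
  simpa only [real_inner_self_eq_norm_sq] using integrable_inner_L2 f f

/-! ### Gradients and test functions. -/

section Gradient

theorem gradient_mul {φ ψ : Plane → ℝ} {x : Plane} (hφ : DifferentiableAt ℝ φ x)
    (hψ : DifferentiableAt ℝ ψ x) :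
    gradient (fun y => φ y * ψ y) x = φ x • gradient ψ x + ψ x • gradient φ x := by
  refine ext_inner_right ℝ fun e => ?_
  rw [inner_gradient_left, fderiv_fun_mul hφ hψ]
  simp [inner_add_left, inner_smul_left, inner_gradient_left]

theorem gradient_comp_real {φ : Plane → ℝ} {T : ℝ → ℝ} {T' : ℝ} {x : Plane}
    (hT : HasDerivAt T T' (φ x)) (hφ : DifferentiableAt ℝ φ x) :
    gradient (fun y => T (φ y)) x = T' • gradient φ x := by
  refine ext_inner_right ℝ fun e => ?_
  have := (hT.comp_hasFDerivAt x hφ.hasFDerivAt).fderiv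
  rw [inner_gradient_left]
  change (fderiv ℝ (T ∘ φ) x) e = _
  rw [this]
  simp [inner_smul_left, inner_gradient_left]

theorem gradient_norm_sq (x : Plane) : gradient (fun y : Plane => ‖y‖ ^ 2) x = (2 : ℝ) • x := by
  refine ext_inner_right ℝ fun e => ?_
  rw [inner_gradient_left, fderiv_norm_sq_apply]
  simp [inner_smul_left]

theorem ContDiff.continuous_gradient' {φ : Plane → ℝ} {n : WithTop ℕ∞} (hφ : ContDiff ℝ n φ)
    (hn : n ≠ 0) : Continuous (gradient φ) :=
  (InnerProductSpace.toDual ℝ Plane).symm.continuous.comp (hφ.continuous_fderiv hn)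

theorem norm_gradient (φ : Plane → ℝ) (x : Plane) : ‖gradient φ x‖ = ‖fderiv ℝ φ x‖ :=
  (InnerProductSpace.toDual ℝ Plane).symm.norm_map _

end Gradient

namespace IsTestFunction

variable {φ ψ : Plane → ℝ}

theorem differentiable (hφ : IsTestFunction φ) : Differentiable ℝ φ :=
  hφ.1.differentiable (by simp)

theorem continuous_gradient (hφ : IsTestFunction φ) : Continuous (gradient φ) :=
  hφ.1.continuous_gradient' (by simp)

theorem hasCompactSupport_gradient (hφ : IsTestFunction φ) : HasCompactSupport (gradient φ) :=
  (hφ.2.fderiv (𝕜 := ℝ)).comp_left (g := (InnerProductSpace.toDual ℝ Plane).symm) (by simp)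

theorem memLp (hφ : IsTestFunction φ) (p : ENNReal) : MemLp φ p (volume : Measure Plane) :=
  hφ.1.continuous.memLp_of_hasCompactSupport hφ.2

theorem memLp_gradient (hφ : IsTestFunction φ) (p : ENNReal) :
    MemLp (gradient φ) p (volume : Measure Plane) :=
  hφ.continuous_gradient.memLp_of_hasCompactSupport hφ.hasCompactSupport_gradient

theorem mul_left (hφ : IsTestFunction φ) (hψ : ContDiff ℝ ∞ ψ) :
    IsTestFunction fun x => ψ x * φ x :=
  ⟨hψ.mul hφ.1, hφ.2.mul_left⟩

/-- A test function as an element of `L²`. -/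
noncomputable def toL2 (hφ : IsTestFunction φ) : L2 ℝ := (hφ.memLp 2).toLp φ

/-- The gradient of a test function as an element of `L²`. -/
noncomputable def gradL2 (hφ : IsTestFunction φ) : L2 Plane := (hφ.memLp_gradient 2).toLp _

theorem coeFn_toL2 (hφ : IsTestFunction φ) : hφ.toL2 =ᵐ[volume] φ := MemLp.coeFn_toLp _

theorem coeFn_gradL2 (hφ : IsTestFunction φ) : hφ.gradL2 =ᵐ[volume] gradient φ :=
  MemLp.coeFn_toLp _

end IsTestFunction

/-! ### Weak gradients and weak divergences. -/

theorem memLp_const_top {E : Type} [NormedAddCommGroup E] (e : E) :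
    MemLp (fun _ : Plane => e) ⊤ (volume : Measure Plane) := memLp_top_const e

/-- Pairing the vector identity with fixed vectors `e` leaves `L²` inner products that are
continuous and linear in `f` and `g`, so weak gradients pass through linear combinations and
integrals in time. -/
theorem hasWeakGradient_iff {f : L2 ℝ} {g : L2 Plane} :
    HasWeakGradient f g ↔ ∀ (φ : Plane → ℝ) (hφ : IsTestFunction φ) (e : Plane),
      inner ℝ (dot (fun _ => e) hφ.gradL2) f = -inner ℝ (vec (fun _ => e) hφ.toL2) g := by
  unfold HasWeakGradient
  refine forall_congr' fun φ => forall_congr' fun hφ => ?_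
  have key : ∀ e : Plane,
      (inner ℝ e (∫ x, f x • gradient φ x) = inner ℝ (dot (fun _ => e) hφ.gradL2) f) ∧
      (inner ℝ e (∫ x, φ x • g x) = inner ℝ (vec (fun _ => e) hφ.toL2) g) := by
    intro e
    constructor
    · rw [← integral_inner ((Lp.memLp f).integrable_smul (hφ.memLp_gradient 2)), inner_L2]
      refine integral_congr_ae ?_
      filter_upwards [coeFn_dot (memLp_const_top e) hφ.gradL2, hφ.coeFn_gradL2] with x hx hx'
      rw [hx, hx', inner_smul_right]
      simp
    · rw [← integral_inner ((hφ.memLp 2).integrable_smul (Lp.memLp g)), inner_L2]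
      refine integral_congr_ae ?_
      filter_upwards [coeFn_vec (memLp_const_top e) hφ.toL2, hφ.coeFn_toL2] with x hx hx'
      rw [hx, hx', inner_smul_right, inner_smul_left]
      simp
  constructor
  · intro h e
    rw [← (key e).1, ← (key e).2, h, inner_neg_right]
  · intro h
    refine ext_inner_left ℝ fun e => ?_
    rw [inner_neg_right, (key e).1, (key e).2, h]

/-- `f` is the distributional divergence of `G`. -/
def IsWeakDivergence (f : L2 ℝ) (G : L2 Plane) : Prop :=
  ∀ (φ : Plane → ℝ) (hφ : IsTestFunction φ), inner ℝ hφ.toL2 f = -inner ℝ hφ.gradL2 G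

namespace HasWeakGradient

variable {f f' : L2 ℝ} {g g' : L2 Plane}

theorem sub (h : HasWeakGradient f g) (h' : HasWeakGradient f' g') :
    HasWeakGradient (f - f' : L2 ℝ) (g - g' : L2 Plane) := by
  rw [hasWeakGradient_iff] at *
  intro φ hφ e
  rw [inner_sub_right, inner_sub_right, h, h']
  ring

theorem smul (h : HasWeakGradient f g) (c : ℝ) :
    HasWeakGradient (c • f : L2 ℝ) (c • g : L2 Plane) := by
  rw [hasWeakGradient_iff] at *
  intro φ hφ e
  rw [inner_smul_right, inner_smul_right, h]
  ring

theorem intervalIntegral {F : ℝ → L2 ℝ} {G : ℝ → L2 Plane} (hF : Continuous F) (hG : Continuous G)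
    (h : ∀ t, HasWeakGradient (F t) (G t)) (a b : ℝ) :
    HasWeakGradient (∫ t in a..b, F t : L2 ℝ) (∫ t in a..b, G t : L2 Plane) := by
  rw [hasWeakGradient_iff]
  intro φ hφ e
  have h1 := (innerSL ℝ (dot (fun _ => e) hφ.gradL2)).intervalIntegral_comp_comm
    (hF.intervalIntegrable (μ := volume) a b)
  have h2 := (innerSL ℝ (vec (fun _ => e) hφ.toL2)).intervalIntegral_comp_comm
    (hG.intervalIntegrable (μ := volume) a b)
  simp only [innerSL_apply_apply] at h1 h2
  rw [← h1, ← h2, ← intervalIntegral.integral_neg]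
  exact intervalIntegral.integral_congr fun t _ => hasWeakGradient_iff.1 (h t) φ hφ e

theorem of_test {φ : Plane → ℝ} (hφ : IsTestFunction φ) :
    HasWeakGradient hφ.toL2 hφ.gradL2 := by
  intro ψ hψ
  have e1 : ∫ x, hφ.toL2 x • gradient ψ x = ∫ x, φ x • gradient ψ x :=
    integral_congr_ae (by filter_upwards [hφ.coeFn_toL2] with x hx; rw [hx])
  have e2 : ∫ x, ψ x • hφ.gradL2 x = ∫ x, ψ x • gradient φ x :=
    integral_congr_ae (by filter_upwards [hφ.coeFn_gradL2] with x hx; rw [hx])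
  rw [e1, e2]
  refine ext_inner_left ℝ fun e => ?_
  have i1 := (hφ.memLp 2).integrable_smul (hψ.memLp_gradient 2)
  have i2 := (hψ.memLp 2).integrable_smul (hφ.memLp_gradient 2)
  have i3 := (hφ.memLp 2).integrable_smul (hψ.memLp 2)
  rw [inner_neg_right, ← integral_inner i1, ← integral_inner i2]
  have c1 := i1.const_inner (𝕜 := ℝ) e
  have c2 := i2.const_inner (𝕜 := ℝ) e
  simp only [inner_smul_right, inner_gradient_right, conj_trivial] at c1 c2 ⊢
  have := integral_mul_fderiv_eq_neg_fderiv_mul_of_integrable (μ := (volume : Measure Plane))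
    (f := φ) (g := ψ) (v := e) (by simpa [mul_comm] using c2) c1 i3
    (fun x _ => hφ.differentiable x) (fun x _ => hψ.differentiable x)
  rw [this]
  simp_rw [mul_comm]

theorem mul_smooth (h : HasWeakGradient f g) {m : Plane → ℝ} (hm : ContDiff ℝ ∞ m)
    (hb : MemLp m ⊤ (volume : Measure Plane))
    (hb' : MemLp (gradient m) ⊤ (volume : Measure Plane)) :
    HasWeakGradient (scal ℝ m f) (scal Plane m g + vec (gradient m) f : L2 Plane) := by
  intro φ hφ
  have H := h _ (hφ.mul_left hm)
  have d : ∀ x, gradient (fun y => m y * φ y) x = m x • gradient φ x + φ x • gradient m x :=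
    fun x => gradient_mul (hm.differentiable (by simp) x) (hφ.differentiable x)
  simp_rw [d] at H
  have e1 : ∫ x, scal ℝ m f x • gradient φ x = ∫ x, (m x * f x) • gradient φ x :=
    integral_congr_ae (by filter_upwards [coeFn_scal hb f] with x hx; rw [hx]; rfl)
  have e2 : ∫ x, φ x • (scal Plane m g + vec (gradient m) f : L2 Plane) x
      = ∫ x, ((m x * φ x) • g x + f x • (φ x • gradient m x)) := by
    refine integral_congr_ae ?_
    filter_upwards [coeFn_scal hb g, coeFn_vec hb' f,
      Lp.coeFn_add (scal Plane m g) (vec (gradient m) f)] with x h1 h2 h3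
    rw [h3, Pi.add_apply, h1, h2, smul_add, smul_smul, smul_comm (φ x) (f x), mul_comm (φ x)]
  have i1 : Integrable fun x => f x • (m x • gradient φ x) :=
    (Lp.memLp f).integrable_smul (((hφ.memLp_gradient 2).smul (r := 2) hb))
  have i2 : Integrable fun x => f x • (φ x • gradient m x) :=
    (Lp.memLp f).integrable_smul ((hb'.smul (r := 2) (hφ.memLp 2)))
  have i3 : Integrable fun x => (m x * φ x) • g x :=
    ((hφ.mul_left hm).memLp 2).integrable_smul (Lp.memLp g)
  simp_rw [smul_add] at H
  rw [integral_add i1 i2] at H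
  rw [e1, e2, integral_add i3 i2, neg_add, ← H]
  simp_rw [smul_smul, mul_comm]
  abel

end HasWeakGradient

namespace IsWeakDivergence

variable {f : L2 ℝ} {g : L2 Plane}

theorem smul (h : IsWeakDivergence f g) (c : ℝ) :
    IsWeakDivergence (c • f) (c • g) := by
  intro φ hφ
  rw [inner_smul_right, inner_smul_right, h]
  ring

end IsWeakDivergence

/-! ### Translations, mollification and testing with `H¹` functions. -/

section Translation

variable {E : Type} [NormedAddCommGroup E]

/-- Translation on `L²`: `(shift y f) x = f (x - y)`. -/
noncomputable def shift (y : Plane) (f : L2 E) : L2 E :=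
  Lp.compMeasurePreserving (fun x : Plane => x - y) (measurePreserving_sub_right volume y) f

theorem coeFn_shift (y : Plane) (f : L2 E) : shift y f =ᵐ[volume] fun x => f (x - y) :=
  Lp.coeFn_compMeasurePreserving f _

theorem shift_zero (f : L2 E) : shift 0 f = f := by
  refine Lp.ext ?_
  filter_upwards [coeFn_shift 0 f] with x hx
  rw [hx, sub_zero]

theorem continuous_shift (f : L2 E) : Continuous fun y => shift y f := by
  have hg : Continuous fun y : Plane => (⟨fun x => x - y, by fun_prop⟩ : C(Plane, Plane)) :=
    ContinuousMap.continuous_of_continuous_uncurry _ (continuous_snd.sub continuous_fst)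
  exact (continuous_const (y := f)).compMeasurePreservingLp hg
    (fun y => measurePreserving_sub_right volume y) (by simp)

variable [InnerProductSpace ℝ E] [CompleteSpace E]

/-- Fubini: averaging translates of `Q` against `ρ` amounts to pairing `F` with the mollification of
`Q`. -/
theorem integral_mul_inner_shift {ρ : Plane → ℝ} (hρ : IsTestFunction ρ) (F Q : L2 E) :
    ∫ y, ρ y * inner ℝ F (shift y Q) = ∫ x, inner ℝ (F x) (∫ t, ρ (x - t) • Q t) := by
  have e1 : ∀ y, ρ y * inner ℝ F (shift y Q) = ∫ x, inner ℝ (F x) (ρ y • Q (x - y)) := by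
    intro y
    rw [inner_L2, ← integral_const_mul]
    refine integral_congr_ae ?_
    filter_upwards [coeFn_shift y Q] with x hx
    rw [hx, inner_smul_right]
  have e2 : ∀ᵐ x, inner ℝ (F x) (∫ t, ρ (x - t) • Q t) = ∫ y, inner ℝ (F x) (ρ y • Q (x - y)) := by
    refine Eventually.of_forall fun x => ?_
    have h1 : ∫ t, ρ (x - t) • Q t = ∫ y, ρ y • Q (x - y) := by
      rw [← integral_sub_left_eq_self (fun t => ρ (x - t) • Q t) volume x]
      simp
    rw [h1, ← integral_inner]
    have hQ : MemLp (fun y => Q (x - y)) 2 (volume : Measure Plane) :=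
      (Lp.memLp Q).comp_measurePreserving (Measure.measurePreserving_sub_left volume x)
    exact (hρ.memLp 2).integrable_smul hQ
  simp_rw [e1]
  rw [integral_congr_ae e2]
  refine (integral_integral_swap ?_).symm
  have meas : AEStronglyMeasurable (fun p : Plane × Plane => inner ℝ (F p.1) (ρ p.2 • Q (p.1 - p.2)))
      (volume.prod volume) :=
    (Lp.aestronglyMeasurable F).comp_fst.inner
      ((hρ.1.continuous.aestronglyMeasurable).convolution_integrand
        (ContinuousLinearMap.lsmul ℝ ℝ) (Lp.aestronglyMeasurable Q))
  have hρi : Integrable fun y => |ρ y| := (memLp_one_iff_integrable.1 (hρ.memLp 1)).abs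
  have i1 : Integrable (fun p : Plane × Plane => ‖F p.1‖ ^ 2 * |ρ p.2|) (volume.prod volume) :=
    (integrable_norm_sq_L2 F).mul_prod hρi
  have i2 : Integrable (fun p : Plane × Plane => |ρ p.2| * ‖Q (p.1 - p.2)‖ ^ 2)
      (volume.prod volume) :=
    hρi.convolution_integrand (ContinuousLinearMap.mul ℝ ℝ) (integrable_norm_sq_L2 Q)
  refine (i1.add i2).mono' meas (Eventually.of_forall fun p => ?_)
  rw [Real.norm_eq_abs]
  refine (abs_real_inner_le_norm _ _).trans ?_
  rw [norm_smul, Real.norm_eq_abs]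
  simp only [Pi.add_apply]
  -- The integrand is dominated by `|ρ(y)| (‖F(x)‖² + ‖Q(x - y)‖²)`, which is integrable on the
  -- product.
  nlinarith [abs_nonneg (ρ p.2), sq_nonneg (‖F p.1‖ - ‖Q (p.1 - p.2)‖),
    mul_nonneg (abs_nonneg (ρ p.2)) (sq_nonneg (‖F p.1‖ - ‖Q (p.1 - p.2)‖)),
    mul_nonneg (abs_nonneg (ρ p.2)) (add_nonneg (sq_nonneg ‖F p.1‖) (sq_nonneg ‖Q (p.1 - p.2)‖))]

end Translation

theorem gradient_comp_const_sub {ρ : Plane → ℝ} (hρ : Differentiable ℝ ρ) (x t : Plane) :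
    gradient (fun s => ρ (x - s)) t = -gradient ρ (x - t) := by
  refine ext_inner_right ℝ fun e => ?_
  have := ((hρ (x - t)).hasFDerivAt.comp t ((hasFDerivAt_id t).const_sub x)).fderiv
  change fderiv ℝ (fun s => ρ (x - s)) t = _ at this
  rw [inner_gradient_left, this]
  simp [inner_gradient_left]

theorem IsTestFunction.comp_const_sub {ρ : Plane → ℝ} (hρ : IsTestFunction ρ) (x : Plane) :
    IsTestFunction fun t => ρ (x - t) :=
  ⟨hρ.1.comp (contDiff_const.sub contDiff_id), hρ.2.comp_homeomorph (Homeomorph.subLeft x)⟩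

/-- `f` vanishes outside the ball of radius `M`. -/
def SupportedIn (M : ℝ) {E : Type} [NormedAddCommGroup E] (f : L2 E) : Prop :=
  ∀ᵐ x : Plane, M < ‖x‖ → f x = 0

/-- Bounded support of `f` makes the convolution a genuine test function; its gradient is found by
testing the weak gradient of `f` against `t ↦ ρ (x - t)`. -/
theorem HasWeakGradient.exists_mollification {f : L2 ℝ} {g : L2 Plane} (h : HasWeakGradient f g)
    {M : ℝ} (hs : SupportedIn M f) {ρ : Plane → ℝ} (hρ : IsTestFunction ρ) :
    ∃ φ : Plane → ℝ, IsTestFunction φ ∧ (∀ x, φ x = ∫ t, ρ (x - t) • f t) ∧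
      ∀ x, gradient φ x = ∫ t, ρ (x - t) • g t := by
  -- A representative vanishing everywhere outside the ball, so that its topological support is
  -- compact.
  set f' : Plane → ℝ := (Metric.closedBall (0 : Plane) M).indicator f with hf'
  have hae : f' =ᵐ[volume] f := by
    filter_upwards [hs] with x hx
    by_cases hM : x ∈ Metric.closedBall (0 : Plane) M
    · rw [hf', Set.indicator_of_mem hM]
    · rw [hf', Set.indicator_of_notMem hM, hx]
      simpa using hM
  have hloc : LocallyIntegrable f' volume :=
    ((Lp.memLp f).ae_eq hae.symm).locallyIntegrable (by norm_num)
  have hsupp : HasCompactSupport f' :=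
    HasCompactSupport.intro (isCompact_closedBall (0 : Plane) M)
      fun x hx => Set.indicator_of_notMem hx _
  have e1 : ∀ x, (convolution f' ρ (ContinuousLinearMap.lsmul ℝ ℝ) volume) x
      = ∫ t, ρ (x - t) • f t := by
    intro x
    refine integral_congr_ae ?_
    filter_upwards [hae] with t ht
    simp [ht, mul_comm]
  refine ⟨convolution f' ρ (ContinuousLinearMap.lsmul ℝ ℝ) volume, ⟨?_, ?_⟩, e1, fun x => ?_⟩
  · exact hρ.2.contDiff_convolution_right _ hloc hρ.1
  · exact hsupp.convolution _ hρ.2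
  · have hd := (hρ.2.hasFDerivAt_convolution_right (ContinuousLinearMap.lsmul ℝ ℝ) hloc
      (hρ.1.of_le (by simp)) x).fderiv
    have hw := h _ (hρ.comp_const_sub x)
    simp_rw [gradient_comp_const_sub hρ.differentiable, smul_neg, integral_neg] at hw
    rw [← neg_inj.1 hw]
    refine ext_inner_left ℝ fun e => ?_
    have hi : Integrable fun t => f t • gradient ρ (x - t) := by
      have := (Lp.memLp f).integrable_smul ((hρ.comp_const_sub x).memLp_gradient 2)
      simp_rw [gradient_comp_const_sub hρ.differentiable, smul_neg] at this
      simpa using this.neg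
    rw [inner_gradient_right, conj_trivial, hd, ← integral_inner hi]
    rw [convolution_precompR_apply _ hloc (hρ.2.fderiv (𝕜 := ℝ))
      (hρ.1.continuous_fderiv (by simp))]
    refine integral_congr_ae ?_
    filter_upwards [hae] with t ht
    simp [ht, inner_smul_right, inner_gradient_right]

/-- The defect at the translate by `y` is a continuous function `c` of `y`. Integrated against any
`ρ` it becomes the weak identity tested on a mollification of `p`, hence zero. So `c` vanishes
identically, and `y = 0` is the claim; no approximate identity is needed. -/
theorem IsWeakDivergence.inner_eq_of_supportedIn {f p : L2 ℝ} {G g : L2 Plane}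
    (hd : IsWeakDivergence f G) (h : HasWeakGradient p g) {M : ℝ} (hs : SupportedIn M p) :
    inner ℝ f p = -inner ℝ G g := by
  set c : Plane → ℝ := fun y => inner ℝ f (shift y p) + inner ℝ G (shift y g) with hc
  have hcont : Continuous c :=
    (continuous_const.inner (continuous_shift p)).add
      (continuous_const.inner (continuous_shift g))
  have hz : ∀ᵐ y, c y = 0 := by
    refine ae_eq_zero_of_integral_contDiff_smul_eq_zero hcont.locallyIntegrable ?_
    intro ρ h1 h2
    have hρ : IsTestFunction ρ := ⟨h1, h2⟩
    obtain ⟨φ, hφ, hφ1, hφ2⟩ := h.exists_mollification hs hρ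
    have i1 : Integrable fun y => ρ y * inner ℝ f (shift y p) :=
      (hρ.1.continuous.mul (continuous_const.inner (continuous_shift p))).integrable_of_hasCompactSupport
        hρ.2.mul_right
    have i2 : Integrable fun y => ρ y * inner ℝ G (shift y g) :=
      (hρ.1.continuous.mul (continuous_const.inner (continuous_shift g))).integrable_of_hasCompactSupport
        hρ.2.mul_right
    simp_rw [hc, smul_eq_mul, mul_add]
    rw [integral_add i1 i2, integral_mul_inner_shift hρ, integral_mul_inner_shift hρ]
    simp_rw [← hφ1, ← hφ2]
    have := hd φ hφ
    rw [real_inner_comm, real_inner_comm G, inner_L2, inner_L2] at this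
    have e1 : ∫ x, inner ℝ (f x) (hφ.toL2 x) = ∫ x, inner ℝ (f x) (φ x) :=
      integral_congr_ae (by filter_upwards [hφ.coeFn_toL2] with x hx; rw [hx])
    have e2 : ∫ x, inner ℝ (G x) (hφ.gradL2 x) = ∫ x, inner ℝ (G x) (gradient φ x) :=
      integral_congr_ae (by filter_upwards [hφ.coeFn_gradL2] with x hx; rw [hx])
    rw [e1, e2] at this
    linarith
  have hz' : c = fun _ => 0 := by
    refine (hcont.ae_eq_iff_eq volume continuous_const).1 hz
  have := congrFun hz' 0
  simp only [hc, shift_zero] at this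
  linarith

section Bounds

variable {E : Type} [NormedAddCommGroup E] [NormedSpace ℝ E]

theorem norm_vec_le {X : Plane → Plane} (hX : MemLp X ⊤ (volume : Measure Plane)) {C : ℝ}
    (hC : ∀ x, ‖X x‖ ≤ C) (f : L2 ℝ) : ‖vec X f‖ ≤ C * ‖f‖ := by
  refine Lp.norm_le_mul_norm_of_ae_le_mul ?_
  filter_upwards [coeFn_vec hX f] with x hx
  rw [hx, norm_smul, mul_comm]
  exact mul_le_mul_of_nonneg_right (hC x) (norm_nonneg _)

end Bounds

theorem inner_scal {E : Type} [NormedAddCommGroup E] [InnerProductSpace ℝ E] {m : Plane → ℝ}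
    (hm : MemLp m ⊤ (volume : Measure Plane)) (f g : L2 E) :
    inner ℝ f (scal E m g) = ∫ x, m x * inner ℝ (f x) (g x) := by
  rw [inner_L2]
  refine integral_congr_ae ?_
  filter_upwards [coeFn_scal hm g] with x hx
  rw [hx, inner_smul_right]

theorem integrable_mul_inner {E : Type} [NormedAddCommGroup E] [InnerProductSpace ℝ E]
    {m : Plane → ℝ} (hm : MemLp m ⊤ (volume : Measure Plane)) (f g : L2 E) :
    Integrable fun x => m x * inner ℝ (f x) (g x) := by
  refine (integrable_inner_L2 f (scal E m g)).congr ?_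
  filter_upwards [coeFn_scal hm g] with x hx
  rw [hx, inner_smul_right]

theorem inner_scal_left {E : Type} [NormedAddCommGroup E] [InnerProductSpace ℝ E] {m : Plane → ℝ}
    (hm : MemLp m ⊤ (volume : Measure Plane)) (f g : L2 E) :
    inner ℝ (scal E m f) g = inner ℝ f (scal E m g) := by
  rw [real_inner_comm, inner_scal hm, inner_scal hm]
  simp_rw [real_inner_comm]

theorem inner_dot {X : Plane → Plane} (hX : MemLp X ⊤ (volume : Measure Plane)) (f : L2 ℝ)
    (g : L2 Plane) : inner ℝ f (dot X g) = ∫ x, f x * inner ℝ (X x) (g x) := by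
  rw [inner_L2]
  refine integral_congr_ae ?_
  filter_upwards [coeFn_dot hX g] with x hx
  rw [hx]
  simp [mul_comm]

theorem integrable_mul_dot {X : Plane → Plane} (hX : MemLp X ⊤ (volume : Measure Plane)) (f : L2 ℝ)
    (g : L2 Plane) : Integrable fun x => f x * inner ℝ (X x) (g x) := by
  refine (integrable_inner_L2 f (dot X g)).congr ?_
  filter_upwards [coeFn_dot hX g] with x hx
  rw [hx]
  simp [mul_comm]

theorem inner_vec {X : Plane → Plane} (hX : MemLp X ⊤ (volume : Measure Plane)) (f : L2 ℝ)
    (g : L2 Plane) : inner ℝ (vec X f) g = ∫ x, f x * inner ℝ (X x) (g x) := by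
  rw [inner_L2]
  refine integral_congr_ae ?_
  filter_upwards [coeFn_vec hX f] with x hx
  rw [hx, inner_smul_left]
  simp

/-- Smooth cutoff functions at scale `R`, with gradients of size `O(1 / R)`. -/
theorem exists_cutoff : ∃ C : ℝ, 0 ≤ C ∧ ∀ R : ℝ, 0 < R → ∃ χ : Plane → ℝ, IsTestFunction χ ∧
    (∀ x, |χ x| ≤ 1) ∧ (∀ x, ‖x‖ ≤ R → χ x = 1) ∧ (∀ x, 2 * R ≤ ‖x‖ → χ x = 0) ∧
    ∀ x, ‖gradient χ x‖ ≤ C / R := by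
  let b : ContDiffBump (0 : Plane) := ⟨1, 2, by norm_num, by norm_num⟩
  have hb : IsTestFunction b := ⟨b.contDiff, b.hasCompactSupport⟩
  obtain ⟨C, hC⟩ := hb.hasCompactSupport_gradient.exists_bound_of_continuous hb.continuous_gradient
  refine ⟨C, (norm_nonneg _).trans (hC 0), fun R hR => ⟨fun x => b (R⁻¹ • x), ⟨?_, ?_⟩, ?_, ?_, ?_,
    ?_⟩⟩
  · exact hb.1.comp (contDiff_const_smul _)
  · exact hb.2.comp_smul (inv_ne_zero hR.ne')
  · intro x
    rw [abs_of_nonneg b.nonneg]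
    exact b.le_one
  · intro x hx
    refine b.one_of_mem_closedBall ?_
    rw [mem_closedBall_zero_iff, norm_smul, Real.norm_of_nonneg (by positivity)]
    change _ ≤ (1 : ℝ)
    rw [inv_mul_le_iff₀ hR]
    linarith
  · intro x hx
    refine b.zero_of_le_dist ?_
    rw [dist_zero_right, norm_smul, Real.norm_of_nonneg (by positivity)]
    change (2 : ℝ) ≤ _
    rw [le_inv_mul_iff₀ hR]
    linarith
  · intro x
    have := ((hb.differentiable (R⁻¹ • x)).hasFDerivAt.comp x
      ((hasFDerivAt_id x).const_smul R⁻¹)).fderiv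
    change fderiv ℝ (fun x => b (R⁻¹ • x)) x = _ at this
    rw [norm_gradient, this]
    simp only [ContinuousLinearMap.comp_smul, ContinuousLinearMap.comp_id]
    rw [norm_smul, Real.norm_of_nonneg (by positivity), ← norm_gradient, div_eq_inv_mul]
    exact mul_le_mul_of_nonneg_left (hC _) (by positivity)

theorem tendsto_inner_scal {E : Type} [NormedAddCommGroup E] [InnerProductSpace ℝ E]
    {m : ℕ → Plane → ℝ} {m' : Plane → ℝ} {C : ℝ}
    (hm : ∀ n, MemLp (m n) ⊤ (volume : Measure Plane))
    (hm' : MemLp m' ⊤ (volume : Measure Plane)) (hC : ∀ n x, |m n x| ≤ C)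
    (hlim : ∀ x, Tendsto (fun n => m n x) atTop (𝓝 (m' x))) (f g : L2 E) :
    Tendsto (fun n => inner ℝ f (scal E (m n) g)) atTop (𝓝 (inner ℝ f (scal E m' g))) := by
  simp_rw [inner_scal (hm _), inner_scal hm']
  refine tendsto_integral_of_dominated_convergence (fun x => C * |inner ℝ (f x) (g x)|)
    (fun n => (integrable_mul_inner (hm n) f g).aestronglyMeasurable)
    ((integrable_inner_L2 f g).abs.const_mul C) ?_ ?_
  · refine fun n => Eventually.of_forall fun x => ?_
    rw [Real.norm_eq_abs, abs_mul]
    exact mul_le_mul_of_nonneg_right (hC n x) (abs_nonneg _)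
  · exact Eventually.of_forall fun x => (hlim x).mul_const _

theorem scal_one {E : Type} [NormedAddCommGroup E] [NormedSpace ℝ E] (f : L2 E) :
    scal E (fun _ => 1) f = f := by
  refine Lp.ext ?_
  filter_upwards [coeFn_scal (memLp_const_top (1 : ℝ)) f] with x hx
  rw [hx, one_smul]

/-- The defining identity of a weak divergence extends from test functions to `H¹`. -/
theorem IsWeakDivergence.inner_eq {f p : L2 ℝ} {G g : L2 Plane}
    (hd : IsWeakDivergence f G) (h : HasWeakGradient p g) : inner ℝ f p = -inner ℝ G g := by
  obtain ⟨C, hC0, hC⟩ := exists_cutoff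
  choose χ h1 h2 h3 h4 h5 using fun n : ℕ => hC (n + 1) (by positivity)
  have hχ : ∀ n, MemLp (χ n) ⊤ (volume : Measure Plane) := fun n => (h1 n).memLp _
  have hχ' : ∀ n, MemLp (gradient (χ n)) ⊤ (volume : Measure Plane) :=
    fun n => (h1 n).memLp_gradient _
  have hlim : ∀ x, Tendsto (fun n => χ n x) atTop (𝓝 1) := by
    intro x
    refine tendsto_const_nhds.congr' ?_
    obtain ⟨N, hN⟩ := exists_nat_ge ‖x‖
    filter_upwards [eventually_ge_atTop N] with n hn
    refine (h3 n x ?_).symm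
    have : (N : ℝ) ≤ n := by exact_mod_cast hn
    linarith
  have key : ∀ n, inner ℝ f (scal ℝ (χ n) p)
      = -(inner ℝ G (scal Plane (χ n) g) + inner ℝ G (vec (gradient (χ n)) p)) := by
    intro n
    rw [← inner_add_right]
    refine hd.inner_eq_of_supportedIn (h.mul_smooth (h1 n).1 (hχ n) (hχ' n))
      (M := 2 * (n + 1)) ?_
    filter_upwards [coeFn_scal (hχ n) p] with x hx hM
    rw [hx, h4 n x hM.le, zero_smul]
  have t1 := tendsto_inner_scal hχ (memLp_const_top (1 : ℝ)) h2 hlim f p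
  have t2 := tendsto_inner_scal hχ (memLp_const_top (1 : ℝ)) h2 hlim G g
  rw [scal_one] at t1 t2
  -- The error from cutting off at scale `n + 1` carries a gradient of size `O(1 / n)`.
  have t3 : Tendsto (fun n => inner ℝ G (vec (gradient (χ n)) p)) atTop (𝓝 0) := by
    have hz : Tendsto (fun n : ℕ => ‖G‖ * (C / (n + 1) * ‖p‖)) atTop (𝓝 0) := by
      have := (tendsto_one_div_add_atTop_nhds_zero_nat (𝕜 := ℝ)).const_mul (‖G‖ * C * ‖p‖)
      rw [mul_zero] at this
      exact this.congr fun n => by ring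
    refine squeeze_zero_norm (fun n => ?_) hz
    refine (norm_inner_le_norm _ _).trans ?_
    exact mul_le_mul_of_nonneg_left (norm_vec_le (hχ' n) (h5 n) p) (norm_nonneg _)
  have t4 := (t2.add t3).neg
  rw [add_zero] at t4
  exact tendsto_nhds_unique t1 (t4.congr fun n => (key n).symm)

/-! ### Density of test functions in `H¹`. -/

namespace IsTestFunction

variable {φ ψ : Plane → ℝ}

theorem add (hφ : IsTestFunction φ) (hψ : IsTestFunction ψ) : IsTestFunction (φ + ψ) :=
  ⟨hφ.1.add hψ.1, hφ.2.add hψ.2⟩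

theorem const_smul (hφ : IsTestFunction φ) (c : ℝ) : IsTestFunction (c • φ) :=
  ⟨contDiff_const.smul hφ.1, hφ.2.smul_left (f := fun _ => c)⟩

theorem toL2_add (hφ : IsTestFunction φ) (hψ : IsTestFunction ψ) :
    (hφ.add hψ).toL2 = hφ.toL2 + hψ.toL2 := rfl

theorem toL2_smul (hφ : IsTestFunction φ) (c : ℝ) : (hφ.const_smul c).toL2 = c • hφ.toL2 := rfl

theorem gradL2_add (hφ : IsTestFunction φ) (hψ : IsTestFunction ψ) :
    (hφ.add hψ).gradL2 = hφ.gradL2 + hψ.gradL2 := by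
  refine Lp.ext ?_
  filter_upwards [(hφ.add hψ).coeFn_gradL2, hφ.coeFn_gradL2, hψ.coeFn_gradL2,
    Lp.coeFn_add hφ.gradL2 hψ.gradL2] with x h1 h2 h3 h4
  rw [h1, h4, Pi.add_apply, h2, h3]
  refine ext_inner_right ℝ fun e => ?_
  rw [inner_add_left]
  simp only [inner_gradient_left]
  rw [fderiv_add (hφ.differentiable x) (hψ.differentiable x)]
  rfl

theorem gradL2_smul (hφ : IsTestFunction φ) (c : ℝ) :
    (hφ.const_smul c).gradL2 = c • hφ.gradL2 := by
  refine Lp.ext ?_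
  filter_upwards [(hφ.const_smul c).coeFn_gradL2, hφ.coeFn_gradL2,
    Lp.coeFn_smul c hφ.gradL2] with x h1 h2 h4
  rw [h1, h4, Pi.smul_apply, h2]
  refine ext_inner_right ℝ fun e => ?_
  rw [inner_smul_left]
  simp only [inner_gradient_left]
  rw [fderiv_const_smul (hφ.differentiable x)]
  rfl

end IsTestFunction

/-- Test functions are dense in `H¹`. -/
theorem HasWeakGradient.exists_test_near {p : L2 ℝ} {g : L2 Plane} (h : HasWeakGradient p g)
    {ε : ℝ} (hε : 0 < ε) : ∃ (φ : Plane → ℝ) (hφ : IsTestFunction φ),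
      ‖p - hφ.toL2‖ < ε ∧ ‖g - hφ.gradL2‖ < ε := by
  let D : Submodule ℝ (WithLp 2 (L2 ℝ × L2 Plane)) :=
    { carrier := {z | ∃ (φ : Plane → ℝ) (hφ : IsTestFunction φ),
        z = WithLp.toLp 2 (hφ.toL2, hφ.gradL2)}
      add_mem' := by
        rintro _ _ ⟨φ, hφ, rfl⟩ ⟨ψ, hψ, rfl⟩
        exact ⟨_, hφ.add hψ, by rw [hφ.toL2_add hψ, hφ.gradL2_add hψ]; rfl⟩
      zero_mem' := by
        have h0 : IsTestFunction (0 : Plane → ℝ) := ⟨contDiff_const, HasCompactSupport.zero⟩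
        refine ⟨_, h0.const_smul 0, ?_⟩
        rw [h0.toL2_smul, h0.gradL2_smul, zero_smul, zero_smul]
        rfl
      smul_mem' := by
        rintro c _ ⟨φ, hφ, rfl⟩
        exact ⟨_, hφ.const_smul c, by rw [hφ.toL2_smul, hφ.gradL2_smul]; rfl⟩ }
  -- A pair orthogonal to all test functions in `H¹` consists of a field and its weak divergence, so
  -- `IsWeakDivergence.inner_eq` makes it orthogonal to `(p, g)` too. Thus `(p, g)` lies in the
  -- double orthogonal complement, the closure of `D`.
  have hmem : WithLp.toLp 2 (p, g) ∈ Dᗮᗮ := by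
    rw [Submodule.mem_orthogonal]
    intro z hz
    rw [Submodule.mem_orthogonal] at hz
    have hd : IsWeakDivergence z.fst z.snd := by
      intro φ hφ
      have := hz _ ⟨φ, hφ, rfl⟩
      rw [WithLp.prod_inner_apply] at this
      exact eq_neg_of_add_eq_zero_left this
    rw [WithLp.prod_inner_apply]
    have := hd.inner_eq h
    change inner ℝ z.fst p + inner ℝ z.snd g = 0
    linarith
  rw [Submodule.orthogonal_orthogonal_eq_closure] at hmem
  have hcl : WithLp.toLp 2 (p, g) ∈ closure (D : Set (WithLp 2 (L2 ℝ × L2 Plane))) := hmem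
  obtain ⟨_, ⟨φ, hφ, rfl⟩, hd⟩ := Metric.mem_closure_iff.1 hcl ε hε
  refine ⟨φ, hφ, ?_, ?_⟩
  · refine lt_of_le_of_lt ?_ hd
    rw [dist_eq_norm, ← WithLp.toLp_sub]
    exact WithLp.norm_fst_le _ (WithLp.toLp 2 ((p, g) - (hφ.toL2, hφ.gradL2)))
  · refine lt_of_le_of_lt ?_ hd
    rw [dist_eq_norm, ← WithLp.toLp_sub]
    exact WithLp.norm_snd_le _ (WithLp.toLp 2 ((p, g) - (hφ.toL2, hφ.gradL2)))

/-! ### Radial integration by parts. -/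

theorem HasWeakGradient.integral_inner {f : L2 ℝ} {g : L2 Plane} (h : HasWeakGradient f g)
    {φ : Plane → ℝ} (hφ : IsTestFunction φ) (e : Plane) :
    ∫ x, f x * inner ℝ (gradient φ x) e = -∫ x, φ x * inner ℝ (g x) e := by
  have := congrArg (inner ℝ e) (h φ hφ)
  rw [inner_neg_right, ← _root_.integral_inner ((Lp.memLp f).integrable_smul (hφ.memLp_gradient 2)),
    ← _root_.integral_inner ((hφ.memLp 2).integrable_smul (Lp.memLp g))] at this
  simpa only [inner_smul_right, real_inner_comm e] using this

theorem gradient_mul_inner {m : Plane → ℝ} {x : Plane} (hm : DifferentiableAt ℝ m x) (e : Plane) :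
    inner ℝ (gradient (fun y => inner ℝ y e * m y) x) e
      = inner ℝ x e * inner ℝ (gradient m x) e + m x * inner ℝ e e := by
  have hd : HasFDerivAt (fun y : Plane => inner ℝ y e) (innerSL ℝ e) x := by
    have := (innerSL ℝ e).hasFDerivAt (x := x)
    refine this.congr_of_eventuallyEq (Eventually.of_forall fun y => ?_)
    simp [real_inner_comm]
  rw [gradient_mul hd.differentiableAt hm, inner_add_left, inner_smul_left, inner_smul_left]
  congr 2
  rw [inner_gradient_left, hd.fderiv]
  simp

/-- Testing against the components of `m x` and summing gives `div (m x) = x · ∇m + 2 m`; the `2` is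
the dimension. -/
theorem HasWeakGradient.integral_radial {p : L2 ℝ} {g : L2 Plane} (h : HasWeakGradient p g)
    {m : Plane → ℝ} (hm : IsTestFunction m) :
    ∫ x, p x * (inner ℝ x (gradient m x) + 2 * m x) = -∫ x, m x * inner ℝ x (g x) := by
  let e : Fin 2 → Plane := EuclideanSpace.basisFun (Fin 2) ℝ
  have hsum : ∀ x y : Plane, ∑ i, inner ℝ x (e i) * inner ℝ y (e i) = inner ℝ x y := by
    intro x y
    simp_rw [real_inner_comm _ y]
    exact (EuclideanSpace.basisFun (Fin 2) ℝ).sum_inner_mul_inner x y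
  have hone : ∀ i, inner ℝ (e i) (e i) = (1 : ℝ) := by
    intro i
    rw [real_inner_self_eq_norm_sq, (EuclideanSpace.basisFun (Fin 2) ℝ).norm_eq_one, one_pow]
  have hc : ∀ i, ContDiff ℝ ∞ fun x : Plane => inner ℝ x (e i) := fun i =>
    contDiff_id.inner ℝ contDiff_const
  have ht := fun i => hm.mul_left (hc i)
  have hi := fun i => h.integral_inner (ht i) (e i)
  have i1 : ∀ i, Integrable fun x =>
      p x * inner ℝ (gradient (fun y => inner ℝ y (e i) * m y) x) (e i) := by
    intro i
    have := ((Lp.memLp p).integrable_smul ((ht i).memLp_gradient 2)).const_inner (𝕜 := ℝ) (e i)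
    simpa only [inner_smul_right, real_inner_comm (e i)] using this
  have i2 : ∀ i, Integrable fun x => inner ℝ x (e i) * m x * inner ℝ (g x) (e i) := by
    intro i
    have := (((ht i).memLp 2).integrable_smul (Lp.memLp g)).const_inner (𝕜 := ℝ) (e i)
    simpa only [inner_smul_right, real_inner_comm (e i)] using this
  have hS := Finset.sum_congr (rfl : (Finset.univ : Finset (Fin 2)) = Finset.univ)
    fun i _ => hi i
  rw [Finset.sum_neg_distrib, ← integral_finsetSum _ fun i _ => i1 i,
    ← integral_finsetSum _ fun i _ => i2 i] at hS
  have e1 : ∀ x, ∑ i, p x * inner ℝ (gradient (fun y => inner ℝ y (e i) * m y) x) (e i)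
      = p x * (inner ℝ x (gradient m x) + 2 * m x) := by
    intro x
    simp_rw [gradient_mul_inner (hm.differentiable x), hone, ← Finset.mul_sum,
      Finset.sum_add_distrib, hsum]
    simp
  have e2 : ∀ x, ∑ i, inner ℝ x (e i) * m x * inner ℝ (g x) (e i) = m x * inner ℝ x (g x) := by
    intro x
    rw [← hsum x (g x), Finset.mul_sum]
    exact Finset.sum_congr rfl fun i _ => by ring
  simp_rw [e1, e2] at hS
  exact hS

/-- Formally this is `2 p ∇p = ∇(p²)`. To stay within `L²`, the divergence of the field `ψ p x` is
computed weakly and then paired with `p` itself, which is allowed since `p` is in `H¹`. -/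
theorem HasWeakGradient.integral_mul_radial {p : L2 ℝ} {g : L2 Plane} (h : HasWeakGradient p g)
    {ψ : Plane → ℝ} (hψ : IsTestFunction ψ) :
    2 * ∫ x, ψ x * (p x * inner ℝ x (g x))
      = -∫ x, (2 * ψ x + inner ℝ x (gradient ψ x)) * p x ^ 2 := by
  have hXc : Continuous fun x : Plane => ψ x • x := hψ.1.continuous.smul continuous_id
  have hX : MemLp (fun x : Plane => ψ x • x) ⊤ (volume : Measure Plane) :=
    hXc.memLp_of_hasCompactSupport hψ.2.smul_right
  have hkc : Continuous fun x : Plane => 2 * ψ x + inner ℝ x (gradient ψ x) :=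
    (continuous_const.mul hψ.1.continuous).add (continuous_id.inner hψ.continuous_gradient)
  have hk : MemLp (fun x : Plane => 2 * ψ x + inner ℝ x (gradient ψ x)) ⊤
      (volume : Measure Plane) := by
    refine hkc.memLp_of_hasCompactSupport (hψ.2.mul_left.add ?_)
    refine hψ.hasCompactSupport_gradient.mono fun x hx => ?_
    simp only [Function.mem_support] at hx ⊢
    intro h0
    rw [h0, inner_zero_right] at hx
    exact hx rfl
  have hd : IsWeakDivergence (scal ℝ (fun x => 2 * ψ x + inner ℝ x (gradient ψ x)) p
      + dot (fun x => ψ x • x) g) (vec (fun x => ψ x • x) p) := by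
    intro φ hφ
    have hr := h.integral_radial (hφ.mul_left hψ.1)
    have hg : ∀ x, inner ℝ x (gradient (fun y => ψ y * φ y) x) + 2 * (ψ x * φ x)
        = ψ x * inner ℝ x (gradient φ x) + (2 * ψ x + inner ℝ x (gradient ψ x)) * φ x := by
      intro x
      rw [gradient_mul (hψ.differentiable x) (hφ.differentiable x), inner_add_right,
        inner_smul_right, inner_smul_right]
      ring
    simp_rw [hg] at hr
    have j1 := integrable_mul_dot hX p hφ.gradL2
    have j2 := integrable_mul_inner hk hφ.toL2 p
    have j1' : Integrable fun x => p x * (ψ x * inner ℝ x (gradient φ x)) := by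
      refine j1.congr ?_
      filter_upwards [hφ.coeFn_gradL2] with x hx
      rw [hx, inner_smul_left]
      simp
    have j2' : Integrable fun x => p x * ((2 * ψ x + inner ℝ x (gradient ψ x)) * φ x) := by
      refine j2.congr ?_
      filter_upwards [hφ.coeFn_toL2] with x hx
      rw [hx]
      simp
      ring
    rw [integral_congr_ae (Eventually.of_forall fun x => mul_add (p x) _ _),
      integral_add j1' j2'] at hr
    rw [inner_add_right, inner_scal hk, inner_dot hX, real_inner_comm, inner_vec hX]
    have q1 : ∫ x, (2 * ψ x + inner ℝ x (gradient ψ x)) * inner ℝ (hφ.toL2 x) (p x)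
        = ∫ x, (p x * ((2 * ψ x + inner ℝ x (gradient ψ x)) * φ x)) := by
      refine integral_congr_ae ?_
      filter_upwards [hφ.coeFn_toL2] with x hx
      rw [hx]
      simp
      ring
    have q2 : ∫ x, p x * inner ℝ (ψ x • x) (hφ.gradL2 x)
        = ∫ x, p x * (ψ x * inner ℝ x (gradient φ x)) := by
      refine integral_congr_ae ?_
      filter_upwards [hφ.coeFn_gradL2] with x hx
      rw [hx, inner_smul_left]
      simp
    have q3 : ∫ x, hφ.toL2 x * inner ℝ (ψ x • x) (g x) = ∫ x, (ψ x * φ x) * inner ℝ x (g x) := by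
      refine integral_congr_ae ?_
      filter_upwards [hφ.coeFn_toL2] with x hx
      rw [hx, inner_smul_left]
      simp
      ring
    rw [q1, q2, q3]
    linarith
  have := hd.inner_eq h
  rw [inner_add_left, inner_scal_left hk, inner_scal hk, real_inner_comm, inner_dot hX,
    inner_vec hX] at this
  have q1 : ∫ x, p x * inner ℝ (ψ x • x) (g x) = ∫ x, ψ x * (p x * inner ℝ x (g x)) := by
    refine integral_congr_ae (Eventually.of_forall fun x => ?_)
    simp only [inner_smul_left, conj_trivial]
    ring
  have q2 : ∫ x, (2 * ψ x + inner ℝ x (gradient ψ x)) * inner ℝ (p x) (p x)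
      = ∫ x, (2 * ψ x + inner ℝ x (gradient ψ x)) * p x ^ 2 := by
    refine integral_congr_ae (Eventually.of_forall fun x => ?_)
    simp only [real_inner_self_eq_norm_sq, Real.norm_eq_abs, sq_abs]
  rw [q1, q2] at this
  linarith

/-! ### Dilations and the Pohozaev inequality. -/

section Dilation

variable {E : Type} [NormedAddCommGroup E]

theorem quasiMeasurePreserving_dilation {c : ℝ} (hc : 0 < c) :
    Measure.QuasiMeasurePreserving (fun x : Plane => c • x) volume volume := by
  refine ⟨measurable_const_smul c, ?_⟩
  rw [Measure.map_addHaar_smul _ hc.ne']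
  exact Measure.smul_absolutelyContinuous

theorem memLp_dilation {c : ℝ} (hc : 0 < c) {f : Plane → E}
    (hf : MemLp f 2 (volume : Measure Plane)) :
    MemLp (fun x => f (c • x)) 2 (volume : Measure Plane) := by
  have hm : MemLp f 2 (Measure.map (fun x : Plane => c • x) volume) := by
    rw [Measure.map_addHaar_smul _ hc.ne']
    exact hf.smul_measure ENNReal.ofReal_ne_top
  exact (memLp_map_measure_iff hm.1 (measurable_const_smul c).aemeasurable).1 hm

theorem integral_dilation [NormedSpace ℝ E] {c : ℝ} (hc : 0 < c) (f : Plane → E) :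
    ∫ x, f (c • x) = (c ^ 2)⁻¹ • ∫ x, f x := by
  rw [Measure.integral_comp_smul, finrank_euclideanSpace_fin, abs_of_pos (by positivity)]

open Classical in
/-- The dilation `f (c ⬝)` of an `L²` function, for `c > 0`. -/
noncomputable def dilate (c : ℝ) (f : L2 E) : L2 E :=
  if h : MemLp (fun x => f (c • x)) 2 (volume : Measure Plane) then h.toLp _ else 0

theorem coeFn_dilate {c : ℝ} (hc : 0 < c) (f : L2 E) :
    dilate c f =ᵐ[volume] fun x => f (c • x) := by
  rw [dilate, dif_pos (memLp_dilation hc (Lp.memLp f))]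
  exact MemLp.coeFn_toLp _

theorem coeFn_dilate_of_ae {c : ℝ} (hc : 0 < c) {f : L2 E} {φ : Plane → E}
    (h : f =ᵐ[volume] φ) : dilate c f =ᵐ[volume] fun x => φ (c • x) := by
  filter_upwards [coeFn_dilate hc f, (quasiMeasurePreserving_dilation hc).ae_eq_comp h]
    with x h1 h2
  rw [h1]
  exact h2

theorem dilate_sub {c : ℝ} (hc : 0 < c) (f g : L2 E) :
    dilate c (f - g) = dilate c f - dilate c g := by
  refine Lp.ext ?_
  filter_upwards [coeFn_dilate hc f, coeFn_dilate hc g,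
    coeFn_dilate_of_ae hc (Lp.coeFn_sub f g), Lp.coeFn_sub (dilate c f) (dilate c g)]
    with x h1 h2 h3 h4
  rw [h3, h4, Pi.sub_apply, Pi.sub_apply, h1, h2]

theorem norm_dilate [InnerProductSpace ℝ E] {c : ℝ} (hc : 0 < c) (f : L2 E) :
    ‖dilate c f‖ = c⁻¹ * ‖f‖ := by
  refine (sq_eq_sq₀ (norm_nonneg _) (by positivity)).1 ?_
  rw [norm_sq_L2, mul_pow, norm_sq_L2 f, inv_pow, ← smul_eq_mul,
    ← integral_dilation hc (fun x => ‖f x‖ ^ 2)]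
  refine integral_congr_ae ?_
  filter_upwards [coeFn_dilate hc f] with x hx
  rw [hx]

end Dilation

theorem gradient_dilation {φ : Plane → ℝ} (hφ : Differentiable ℝ φ) (c : ℝ) (x : Plane) :
    gradient (fun y => φ (c • y)) x = c • gradient φ (c • x) := by
  refine ext_inner_right ℝ fun e => ?_
  have := ((hφ (c • x)).hasFDerivAt.comp x ((hasFDerivAt_id x).const_smul c)).fderiv
  change fderiv ℝ (fun y => φ (c • y)) x = _ at this
  rw [inner_gradient_left, this]
  simp [inner_smul_left, inner_gradient_left]

theorem IsTestFunction.dilation {φ : Plane → ℝ} (hφ : IsTestFunction φ) {c : ℝ} (hc : 0 < c) :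
    IsTestFunction fun x => φ (c • x) :=
  ⟨hφ.1.comp (contDiff_const_smul _), hφ.2.comp_smul hc.ne'⟩

theorem HasWeakGradient.dilate {p : L2 ℝ} {g : L2 Plane} (h : HasWeakGradient p g) {c : ℝ}
    (hc : 0 < c) : HasWeakGradient (dilate c p) (c • dilate c g : L2 Plane) := by
  intro φ hφ
  have hψ := hφ.dilation (inv_pos.2 hc)
  have H := h _ hψ
  simp_rw [gradient_dilation hφ.differentiable] at H
  have e1 : ∫ x, (_root_.dilate c p) x • gradient φ x
      = ∫ x, (fun y => p y • gradient φ (c⁻¹ • y)) (c • x) := by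
    refine integral_congr_ae ?_
    filter_upwards [coeFn_dilate hc p] with x hx
    rw [hx, smul_smul, inv_mul_cancel₀ hc.ne', one_smul]
  have e2 : ∫ x, φ x • (c • _root_.dilate c g : L2 Plane) x
      = ∫ x, (fun y => c • (φ (c⁻¹ • y) • g y)) (c • x) := by
    refine integral_congr_ae ?_
    filter_upwards [coeFn_dilate hc g, Lp.coeFn_smul c (_root_.dilate c g)] with x hx hx'
    rw [hx', Pi.smul_apply, hx, smul_smul c⁻¹, inv_mul_cancel₀ hc.ne', one_smul, smul_comm]
  rw [e1, e2, integral_dilation hc (fun y => p y • gradient φ (c⁻¹ • y)),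
    integral_dilation hc (fun y => c • (φ (c⁻¹ • y) • g y)), integral_smul, ← smul_neg]
  congr 1
  rw [← smul_neg, ← H, ← integral_smul]
  refine integral_congr_ae (Eventually.of_forall fun x => ?_)
  simp only
  rw [smul_comm (p x) c⁻¹, smul_smul, mul_inv_cancel₀ hc.ne', one_smul]

/-- The Dirichlet integral is dilation invariant in dimension two, so `K x ≤ K (c • x)` says that
the dilate of `p` has no larger `K`-weighted Dirichlet integral than `p`. By Cauchy–Schwarz `p` then
pairs at least as much with itself as with its dilate in that form, and `f` pairs with minus that
form. -/
theorem IsWeakDivergence.inner_sub_dilate_nonpos {f p : L2 ℝ} {g : L2 Plane} {K : Plane → ℝ}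
    (hKb : MemLp K ⊤ (volume : Measure Plane)) (hK0 : ∀ x, 0 ≤ K x)
    (hd : IsWeakDivergence f (scal Plane K g)) (h : HasWeakGradient p g) {c : ℝ} (hc : 0 < c)
    (hKc : ∀ x, K x ≤ K (c • x)) : inner ℝ f (p - dilate c p) ≤ 0 := by
  rw [hd.inner_eq (h.sub (h.dilate hc)), inner_sub_right, inner_scal_left hKb,
    inner_scal_left hKb, inner_scal hKb, inner_scal hKb]
  have hcg : (c • dilate c g : L2 Plane) =ᵐ[volume] fun x => c • g (c • x) := by
    filter_upwards [coeFn_dilate hc g, Lp.coeFn_smul c (dilate c g)] with x hx hx'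
    rw [hx', Pi.smul_apply, hx]
  have i0 := integrable_mul_inner hKb g g
  have i1 := integrable_mul_inner hKb g (c • dilate c g)
  have i2 := integrable_mul_inner hKb (c • dilate c g) (c • dilate c g)
  have a1 : ∫ x, K x * inner ℝ (g x) ((c • dilate c g : L2 Plane) x)
      ≤ ∫ x, (1 / 2 * (K x * inner ℝ (g x) (g x)) + 1 / 2 * (K x * inner ℝ
        ((c • dilate c g : L2 Plane) x) ((c • dilate c g : L2 Plane) x))) := by
    refine integral_mono i1 ((i0.const_mul _).add (i2.const_mul _)) fun x => ?_
    simp only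
    have := real_inner_self_nonneg (x := g x - (c • dilate c g : L2 Plane) x)
    rw [real_inner_sub_sub_self] at this
    nlinarith [mul_nonneg (hK0 x) this]
  have a2 : ∫ x, K x * inner ℝ ((c • dilate c g : L2 Plane) x) ((c • dilate c g : L2 Plane) x)
      ≤ ∫ x, K x * inner ℝ (g x) (g x) := by
    have b1 : ∫ x, K x * inner ℝ ((c • dilate c g : L2 Plane) x) ((c • dilate c g : L2 Plane) x)
        ≤ ∫ x, (fun y => c ^ 2 * (K y * inner ℝ (g y) (g y))) (c • x) := by
      refine integral_mono_ae i2 ?_ ?_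
      · exact (i0.const_mul _).comp_smul hc.ne'
      · filter_upwards [hcg] with x hx
        rw [hx, inner_smul_left, inner_smul_right]
        simp only [conj_trivial]
        have := mul_le_mul_of_nonneg_right (hKc x)
          (real_inner_self_nonneg (x := g (c • x)))
        nlinarith [mul_le_mul_of_nonneg_left this (sq_nonneg c)]
    rwa [integral_dilation hc (fun y => c ^ 2 * (K y * inner ℝ (g y) (g y))), integral_const_mul, smul_eq_mul,
      inv_mul_cancel_left₀ (by positivity)] at b1
  rw [integral_add (i0.const_mul _) (i2.const_mul _), integral_const_mul, integral_const_mul] at a1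
  linarith

namespace IsTestFunction

variable {ψ φ : Plane → ℝ}

theorem continuous_radial (hψ : IsTestFunction ψ) :
    Continuous fun x => inner ℝ x (gradient ψ x) :=
  continuous_id.inner hψ.continuous_gradient

theorem hasCompactSupport_radial (hψ : IsTestFunction ψ) :
    HasCompactSupport fun x => inner ℝ x (gradient ψ x) := by
  refine hψ.hasCompactSupport_gradient.mono fun x hx => ?_
  simp only [Function.mem_support] at hx ⊢
  intro h0
  rw [h0, inner_zero_right] at hx
  exact hx rfl

/-- The radial derivative `x ⬝ ∇ψ` of a test function in `L²`. -/
noncomputable def radial (hψ : IsTestFunction ψ) : L2 ℝ :=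
  (hψ.continuous_radial.memLp_of_hasCompactSupport hψ.hasCompactSupport_radial).toLp _

theorem coeFn_radial (hψ : IsTestFunction ψ) :
    hψ.radial =ᵐ[volume] fun x => inner ℝ x (gradient ψ x) := MemLp.coeFn_toLp _

theorem inner_dilate (hψ : IsTestFunction ψ) (f : L2 ℝ) {c : ℝ} (hc : 0 < c) :
    inner ℝ f (dilate c hψ.toL2) = ∫ x, f x * ψ (c • x) := by
  rw [inner_L2]
  refine integral_congr_ae ?_
  filter_upwards [coeFn_dilate_of_ae hc hψ.coeFn_toL2] with x hx
  rw [hx]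
  simp [mul_comm]

theorem hasDerivAt_inner_dilate (hψ : IsTestFunction ψ) (f : L2 ℝ) {c : ℝ} (hc : 1 / 2 < c) :
    HasDerivAt (fun s => inner ℝ f (dilate s hψ.toL2))
      (c⁻¹ * inner ℝ f (dilate c hψ.radial)) c := by
  obtain ⟨B, hB⟩ := hψ.hasCompactSupport_gradient.exists_bound_of_continuous hψ.continuous_gradient
  obtain ⟨M, hM⟩ := hψ.hasCompactSupport_gradient.isCompact.isBounded.subset_closedBall
    (0 : Plane)
  have hgz : ∀ x : Plane, M < ‖x‖ → gradient ψ x = 0 := by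
    intro x hx
    by_contra hne
    have := hM (subset_tsupport _ hne)
    rw [mem_closedBall_zero_iff] at this
    linarith
  have hB0 : 0 ≤ B := (norm_nonneg _).trans (hB 0)
  -- For `s > 1/2` the function `∇ψ(s x)` vanishes outside the ball of radius `2 M`, which gives one
  -- dominating function for all such `s`.
  set bound : Plane → ℝ := (Metric.closedBall (0 : Plane) (2 * M)).indicator
    fun _ => 2 * |M| * B with hbound
  have hbm : MemLp bound 2 (volume : Measure Plane) :=
    memLp_indicator_const 2 Metric.isClosed_closedBall.measurableSet _
      (Or.inr (isCompact_closedBall _ _).measure_lt_top.ne)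
  have hbd : ∀ x : Plane, ∀ s ∈ Set.Ioi (1 / 2 : ℝ),
      |inner ℝ x (gradient ψ (s • x))| ≤ bound x := by
    intro x s hs
    simp only [Set.mem_Ioi] at hs
    by_cases hx : x ∈ Metric.closedBall (0 : Plane) (2 * M)
    · rw [hbound, Set.indicator_of_mem hx]
      refine (abs_real_inner_le_norm _ _).trans ?_
      rw [mem_closedBall_zero_iff] at hx
      refine mul_le_mul (hx.trans ?_) (hB _) (norm_nonneg _) (by positivity)
      nlinarith [le_abs_self M]
    · rw [hbound, Set.indicator_of_notMem hx]
      rw [mem_closedBall_zero_iff, not_le] at hx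
      rw [hgz, inner_zero_right, abs_zero]
      rw [norm_smul, Real.norm_of_nonneg (by linarith)]
      nlinarith [norm_nonneg x]
  have hder : ∀ x : Plane, ∀ s : ℝ, HasDerivAt (fun s => f x * ψ (s • x))
      (f x * inner ℝ x (gradient ψ (s • x))) s := by
    intro x s
    refine HasDerivAt.const_mul _ ?_
    have h1 : HasDerivAt (fun s : ℝ => s • x) ((1 : ℝ) • x) s := (hasDerivAt_id s).smul_const x
    have := (hψ.differentiable (s • x)).hasFDerivAt.comp_hasDerivAt s h1
    rw [one_smul] at this
    rw [inner_gradient_right, conj_trivial]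
    exact this
  have hfm : ∀ s : ℝ, AEStronglyMeasurable (fun x => f x * ψ (s • x)) volume := fun s =>
    (Lp.aestronglyMeasurable f).mul
      (hψ.1.continuous.comp (continuous_const_smul s)).aestronglyMeasurable
  have main := hasDerivAt_integral_of_dominated_loc_of_deriv_le (μ := (volume : Measure Plane))
    (F := fun s x => f x * ψ (s • x)) (F' := fun s x => f x * inner ℝ x (gradient ψ (s • x)))
    (bound := fun x => |f x| * bound x) (x₀ := c) (s := Set.Ioi (1 / 2 : ℝ)) (Ioi_mem_nhds hc)
    (Eventually.of_forall hfm)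
    ((Lp.memLp f).integrable_smul ((hψ.dilation (by linarith)).memLp 2))
    ((Lp.aestronglyMeasurable f).mul (continuous_id.inner
      (hψ.continuous_gradient.comp (continuous_const_smul c))).aestronglyMeasurable)
    (Eventually.of_forall fun x s hs => by
      rw [Real.norm_eq_abs, abs_mul]
      exact mul_le_mul_of_nonneg_left (hbd x s hs) (abs_nonneg _))
    ((Lp.memLp f).norm.integrable_smul hbm)
    (Eventually.of_forall fun x s _ => hder x s)
  have e1 : c⁻¹ * inner ℝ f (dilate c hψ.radial)
      = ∫ x, f x * inner ℝ x (gradient ψ (c • x)) := by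
    rw [inner_L2, ← integral_const_mul]
    refine integral_congr_ae ?_
    filter_upwards [coeFn_dilate_of_ae (c := c) (by linarith) hψ.coeFn_radial] with x hx
    rw [hx, inner_smul_left]
    simp only [conj_trivial, RCLike.inner_apply]
    have : c ≠ 0 := by linarith
    field_simp
  rw [e1]
  refine main.2.congr_of_eventuallyEq ?_
  filter_upwards [Ioi_mem_nhds hc] with s hs
  exact hψ.inner_dilate f (by simp only [Set.mem_Ioi] at hs; linarith)

theorem dilate_one {E : Type} [NormedAddCommGroup E] (f : L2 E) : dilate 1 f = f := by
  refine Lp.ext ?_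
  filter_upwards [coeFn_dilate one_pos f] with x hx
  rw [hx, one_smul]

/-- Mean value inequality in the dilation parameter. The `4` is two factors `s⁻¹ ≤ 2`, one from the
chain rule and one from the norm of a dilate. Only the radial derivative of `ψ` enters, so the bound
is small when that derivative is. -/
theorem abs_inner_sub_dilate_le (hψ : IsTestFunction ψ) (f : L2 ℝ) {c : ℝ} (hc : 1 / 2 < c)
    (hc1 : c ≤ 1) :
    |inner ℝ f (hψ.toL2 - dilate c hψ.toL2)| ≤ 4 * ‖f‖ * ‖hψ.radial‖ * (1 - c) := by
  have := Convex.norm_image_sub_le_of_norm_hasDerivWithin_le (𝕜 := ℝ)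
    (f := fun s => inner ℝ f (dilate s hψ.toL2)) (s := Set.Icc c 1)
    (f' := fun s => s⁻¹ * inner ℝ f (dilate s hψ.radial)) (C := 4 * ‖f‖ * ‖hψ.radial‖)
    (x := c) (y := 1)
    (fun s hs => (hψ.hasDerivAt_inner_dilate f (hc.trans_le hs.1)).hasDerivWithinAt) ?_
    (convex_Icc _ _) (Set.left_mem_Icc.2 hc1) (Set.right_mem_Icc.2 hc1)
  · simp only [dilate_one] at this
    rwa [← inner_sub_right, Real.norm_eq_abs, Real.norm_of_nonneg (by linarith)] at this
  · intro s hs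
    have hs0 : 1 / 2 < s := hc.trans_le hs.1
    have hspos : 0 < s := by linarith
    rw [norm_mul, norm_inv, Real.norm_of_nonneg hspos.le]
    have h1 : ‖inner ℝ f (dilate s hψ.radial)‖ ≤ ‖f‖ * (s⁻¹ * ‖hψ.radial‖) := by
      rw [← norm_dilate hspos]
      exact norm_inner_le_norm _ _
    have h2 : s⁻¹ ≤ 2 := by
      rw [inv_le_comm₀ hspos two_pos]
      linarith
    calc s⁻¹ * ‖inner ℝ f (dilate s hψ.radial)‖ ≤ s⁻¹ * (‖f‖ * (s⁻¹ * ‖hψ.radial‖)) := by gcongr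
      _ ≤ 2 * (‖f‖ * (2 * ‖hψ.radial‖)) := by gcongr
      _ = _ := by ring

theorem radial_sub (hφ : IsTestFunction φ) (hψ : IsTestFunction ψ) :
    ∃ hsub : IsTestFunction (φ - ψ), hsub.toL2 = hφ.toL2 - hψ.toL2 ∧
      hsub.radial = hφ.radial - hψ.radial := by
  have hsub : IsTestFunction (φ - ψ) := ⟨hφ.1.sub hψ.1, hφ.2.sub hψ.2⟩
  refine ⟨hsub, rfl, Lp.ext ?_⟩
  filter_upwards [hsub.coeFn_radial, hφ.coeFn_radial, hψ.coeFn_radial,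
    Lp.coeFn_sub hφ.radial hψ.radial] with x h1 h2 h3 h4
  rw [h1, h4, Pi.sub_apply, h2, h3, ← inner_sub_right]
  congr 1
  refine ext_inner_right ℝ fun e => ?_
  rw [inner_sub_left]
  simp only [inner_gradient_left]
  rw [fderiv_sub (hφ.differentiable x) (hψ.differentiable x)]
  rfl

end IsTestFunction

/-- The unbounded factor `x` is harmless on bounded supports: cutting off by `χ` sends `H¹`
approximations to approximations of both `p` and `x · ∇p`, through operators bounded on `L²` that
reproduce `p` and `q`. `A` exceeds the norms involved. -/
theorem HasWeakGradient.exists_test_near_radial {p q : L2 ℝ} {g : L2 Plane}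
    (h : HasWeakGradient p g) {M : ℝ} (hM : 0 < M) (hp : SupportedIn M p) (hg : SupportedIn M g)
    (hq : q =ᵐ[volume] fun x => inner ℝ x (g x)) {ε : ℝ} (hε : 0 < ε) :
    ∃ (φ : Plane → ℝ) (hφ : IsTestFunction φ), ‖p - hφ.toL2‖ < ε ∧ ‖q - hφ.radial‖ < ε := by
  obtain ⟨C, -, hC⟩ := exists_cutoff
  obtain ⟨χ, h1, h2, h3, -, -⟩ := hC (M + 1) (by linarith)
  have hχ := h1.memLp ⊤
  have hX : MemLp (fun x : Plane => χ x • x) ⊤ (volume : Measure Plane) :=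
    (h1.1.continuous.smul continuous_id).memLp_of_hasCompactSupport h1.2.smul_right
  have hk : MemLp (fun x : Plane => inner ℝ x (gradient χ x)) ⊤ (volume : Measure Plane) :=
    h1.continuous_radial.memLp_of_hasCompactSupport h1.hasCompactSupport_radial
  have hχ0 : ∀ x : Plane, ‖x‖ ≤ M → gradient χ x = 0 := by
    intro x hx
    have : χ =ᶠ[𝓝 x] fun _ => 1 := by
      have : Metric.ball (0 : Plane) (M + 1) ∈ 𝓝 x :=
        Metric.isOpen_ball.mem_nhds (by rw [mem_ball_zero_iff]; linarith)
      filter_upwards [this] with y hy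
      exact h3 y (mem_ball_zero_iff.1 hy).le
    rw [this.gradient_eq, gradient_fun_const]
  have ep : scal ℝ χ p = p := by
    refine Lp.ext ?_
    filter_upwards [coeFn_scal hχ p, hp] with x hx hx'
    rw [hx]
    by_cases hxM : ‖x‖ ≤ M
    · rw [h3 x (by linarith), one_smul]
    · rw [hx' (not_le.1 hxM), smul_zero]
  have eq : dot (fun x => χ x • x) g + scal ℝ (fun x => inner ℝ x (gradient χ x)) p = q := by
    refine Lp.ext ?_
    filter_upwards [coeFn_scal hk p, hp, coeFn_dot hX g, hg, hq, Lp.coeFn_add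
      (dot (fun x => χ x • x) g) (scal ℝ (fun x => inner ℝ x (gradient χ x)) p)]
      with x y1 y2 y3 y4 y5 y6
    rw [y6, Pi.add_apply, y1, y3, y5]
    by_cases hxM : ‖x‖ ≤ M
    · rw [h3 x (by linarith), one_smul, hχ0 x hxM, inner_zero_right, zero_smul, add_zero]
    · rw [y2 (not_le.1 hxM), y4 (not_le.1 hxM), smul_zero, inner_zero_right, inner_zero_right,
        add_zero]
  set A := ‖scal ℝ χ‖ + ‖dot (fun x => χ x • x)‖ + ‖scal ℝ (fun x => inner ℝ x (gradient χ x))‖ + 1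
    with hA
  have hA0 : 0 < A := by positivity
  obtain ⟨φ, hφ, n1, n2⟩ := h.exists_test_near (ε := ε / A) (by positivity)
  have hψ := hφ.mul_left h1.1
  have et : hψ.toL2 = scal ℝ χ hφ.toL2 := by
    refine Lp.ext ?_
    filter_upwards [coeFn_scal hχ hφ.toL2, hψ.coeFn_toL2, hφ.coeFn_toL2] with x y1 y2 y3
    rw [y1, y2, y3, smul_eq_mul]
  have er : hψ.radial = dot (fun x => χ x • x) hφ.gradL2
      + scal ℝ (fun x => inner ℝ x (gradient χ x)) hφ.toL2 := by
    refine Lp.ext ?_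
    filter_upwards [coeFn_scal hk hφ.toL2, hφ.coeFn_toL2, coeFn_dot hX hφ.gradL2,
      hφ.coeFn_gradL2, hψ.coeFn_radial, Lp.coeFn_add (dot (fun x => χ x • x) hφ.gradL2)
      (scal ℝ (fun x => inner ℝ x (gradient χ x)) hφ.toL2)] with x y1 y2 y3 y4 y5 y6
    rw [y6, Pi.add_apply, y1, y3, y5, y2, y4, gradient_mul (h1.differentiable x)
      (hφ.differentiable x), inner_add_right, inner_smul_right, inner_smul_right, inner_smul_left]
    simp [mul_comm]
  refine ⟨_, hψ, ?_, ?_⟩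
  · rw [et]
    nth_rewrite 1 [← ep]
    rw [← map_sub]
    refine (ContinuousLinearMap.le_opNorm _ _).trans_lt ?_
    calc ‖scal ℝ χ‖ * ‖p - hφ.toL2‖ ≤ ‖scal ℝ χ‖ * (ε / A) := by gcongr
      _ < A * (ε / A) := by
        refine mul_lt_mul_of_pos_right ?_ (by positivity)
        rw [hA]
        linarith [norm_nonneg (dot fun x => χ x • x),
          norm_nonneg (scal ℝ (fun x => inner ℝ x (gradient χ x)))]
      _ = ε := by field_simp
  · rw [er, ← eq, add_sub_add_comm, ← map_sub, ← map_sub]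
    refine (norm_add_le _ _).trans_lt ?_
    calc _ ≤ ‖dot (fun x => χ x • x)‖ * ‖g - hφ.gradL2‖
          + ‖scal ℝ (fun x => inner ℝ x (gradient χ x))‖ * ‖p - hφ.toL2‖ :=
        add_le_add (ContinuousLinearMap.le_opNorm _ _) (ContinuousLinearMap.le_opNorm _ _)
      _ ≤ ‖dot (fun x => χ x • x)‖ * (ε / A)
          + ‖scal ℝ (fun x => inner ℝ x (gradient χ x))‖ * (ε / A) := by gcongr
      _ = (‖dot (fun x => χ x • x)‖ + ‖scal ℝ (fun x => inner ℝ x (gradient χ x))‖) * (ε / A) := by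
        ring
      _ < A * (ε / A) := by
        refine mul_lt_mul_of_pos_right ?_ (by positivity)
        rw [hA]
        linarith [norm_nonneg (scal ℝ χ)]
      _ = ε := by field_simp

/-- A Pohozaev inequality: if `K` is radially nonincreasing and `f = ∇ ⬝ (K ∇p)`, then
`∫ f x ⬝ ∇p ≤ 0`. -/
theorem IsWeakDivergence.inner_radial_nonpos {f p q : L2 ℝ} {g : L2 Plane} {K : Plane → ℝ}
    (hKb : MemLp K ⊤ (volume : Measure Plane)) (hK0 : ∀ x, 0 ≤ K x)
    (hK : ∀ c : ℝ, 0 < c → c ≤ 1 → ∀ x, K x ≤ K (c • x))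
    (hd : IsWeakDivergence f (scal Plane K g)) (h : HasWeakGradient p g) {M : ℝ} (hM : 0 < M)
    (hp : SupportedIn M p) (hg : SupportedIn M g)
    (hq : q =ᵐ[volume] fun x => inner ℝ x (g x)) : inner ℝ f q ≤ 0 := by
  -- The errors below add up to `12 ‖f‖ ε`; the `20` leaves slack.
  have key : ∀ ε : ℝ, 0 < ε → inner ℝ f q ≤ 20 * ‖f‖ * ε := by
    intro ε hε
    obtain ⟨ψ, hψ, -, n2⟩ := h.exists_test_near_radial hM hp hg hq hε
    -- The test function `ψ` must not depend on `c`, as the limit `c → 1` is taken for it. For each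
    -- `c` an auxiliary `φ` approximates `p` within `ε (1 - c)`, so that the error survives division
    -- by `1 - c`. The mean value bound for `ψ - φ` costs `8`, the exchange of `φ` for `p` costs
    -- `3`, and `p` itself contributes a nonpositive term.
    have hbound : ∀ c : ℝ, 1 / 2 < c → c < 1 →
        inner ℝ f (hψ.toL2 - dilate c hψ.toL2) ≤ 11 * ‖f‖ * ε * (1 - c) := by
      intro c hc hc1
      have hc0 : 0 < c := by linarith
      obtain ⟨φ, hφ, m1, m2⟩ := h.exists_test_near_radial hM hp hg hq
        (ε := min ε (ε * (1 - c))) (lt_min hε (mul_pos hε (by linarith)))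
      obtain ⟨hs, hs1, hs2⟩ := hψ.radial_sub hφ
      have b1 := (le_abs_self _).trans (hs.abs_inner_sub_dilate_le f hc hc1.le)
      rw [hs1, hs2, dilate_sub hc0] at b1
      have b2 : ‖hψ.radial - hφ.radial‖ ≤ 2 * ε := by
        have : hψ.radial - hφ.radial = (q - hφ.radial) - (q - hψ.radial) := by abel
        rw [this]
        refine (norm_sub_le _ _).trans ?_
        linarith [min_le_left ε (ε * (1 - c))]
      have b3 := hd.inner_sub_dilate_nonpos hKb hK0 h hc0 (hK c hc0 hc1.le)
      have b4 : |inner ℝ f ((p - hφ.toL2) - dilate c (p - hφ.toL2))| ≤ ‖f‖ * (3 * (ε * (1 - c))) := by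
        refine (abs_real_inner_le_norm _ _).trans ?_
        refine mul_le_mul_of_nonneg_left ((norm_sub_le _ _).trans ?_) (norm_nonneg _)
        rw [norm_dilate hc0]
        have h2 : c⁻¹ ≤ 2 := by
          rw [inv_le_comm₀ hc0 two_pos]
          linarith
        have h3 : ‖p - hφ.toL2‖ ≤ ε * (1 - c) := m1.le.trans (min_le_right _ _)
        nlinarith [norm_nonneg (p - hφ.toL2)]
      have b5 := neg_le_of_abs_le b4
      rw [dilate_sub hc0] at b5
      simp only [inner_sub_right] at b1 b3 b5 ⊢
      have b6 : 4 * ‖f‖ * ‖hψ.radial - hφ.radial‖ * (1 - c) ≤ 4 * ‖f‖ * (2 * ε) * (1 - c) := by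
        have : 0 ≤ 1 - c := by linarith
        gcongr
      linarith
    have hder := hψ.hasDerivAt_inner_dilate f (c := 1) (by norm_num)
    rw [inv_one, one_mul, IsTestFunction.dilate_one] at hder
    have hslope := (hasDerivAt_iff_tendsto_slope.1 hder).mono_left
      (nhdsWithin_mono (1 : ℝ) (fun c (hc : c ∈ Set.Iio 1) => ne_of_lt hc))
    have hlim : inner ℝ f hψ.radial ≤ 11 * ‖f‖ * ε := by
      refine le_of_tendsto hslope ?_
      filter_upwards [Ioo_mem_nhdsLT (show (1 / 2 : ℝ) < 1 by norm_num)] with c hc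
      have := hbound c hc.1 hc.2
      rw [slope_def_field, IsTestFunction.dilate_one, div_le_iff_of_neg (by linarith [hc.2])]
      rw [inner_sub_right] at this
      linarith
    have hfin : inner ℝ f (q - hψ.radial) ≤ ‖f‖ * ε :=
      (real_inner_le_norm _ _).trans (mul_le_mul_of_nonneg_left n2.le (norm_nonneg _))
    rw [inner_sub_right] at hfin
    nlinarith [norm_nonneg f]
  refine le_of_forall_pos_le_add fun δ hδ => ?_
  have h1 : 0 < 20 * ‖f‖ + 1 := by positivity
  refine (key (δ / (20 * ‖f‖ + 1)) (by positivity)).trans ?_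
  rw [zero_add, mul_div_assoc', div_le_iff₀ h1]
  nlinarith [norm_nonneg f]

/-! ### The logarithmic Hardy inequality. -/

theorem memLp_inv_one_add_norm_sq :
    MemLp (fun x : Plane => (1 + ‖x‖ ^ 2)⁻¹) ⊤ (volume : Measure Plane) := by
  refine memLp_top_of_continuous (C := 1) ?_ fun x => ?_
  · exact (continuous_const.add (continuous_norm.pow 2)).inv₀
      fun x => ne_of_gt (show (0 : ℝ) < 1 + ‖x‖ ^ 2 by positivity)
  · rw [Real.norm_of_nonneg (by positivity)]
    exact inv_le_one_of_one_le₀ (by nlinarith [sq_nonneg ‖x‖])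

/-- The profile `q = 2 / ((1 + s) (L - log (1 + s)))` used in the logarithmic Hardy inequality. -/
theorem hasDerivAt_hardyProfile {L s : ℝ} (hs : 0 ≤ s) (hL : 0 < L - Real.log (1 + s)) :
    HasDerivAt (fun s => 2 / ((1 + s) * (L - Real.log (1 + s))))
      (-2 * (L - Real.log (1 + s) - 1) / ((1 + s) * (L - Real.log (1 + s))) ^ 2) s := by
  have h1 : HasDerivAt (fun s : ℝ => 1 + s) 1 s := (hasDerivAt_id s).const_add 1
  have h1s : 1 + s ≠ 0 := by positivity
  have h2 : HasDerivAt (fun s => L - Real.log (1 + s)) (-(1 / (1 + s))) s :=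
    (h1.log h1s).const_sub L
  have h3 := (hasDerivAt_const s (2 : ℝ)).div (h1.mul h2) (mul_ne_zero h1s hL.ne')
  refine h3.congr_deriv ?_
  congr 1
  field_simp
  ring

/-- With `s = |x|²` and `φ = L - log (1 + s)`, the field `F x` is `-∇ log φ`, and `-Δφ = 4 / (1 +
s)²`. This gives the Riccati identity `div (F x) = |F x|² + 4 / (φ (1 + s)²)` behind `e1`; the term
`|F x|²` is then used to complete a square. -/
theorem hardy_pointwise {φ s w v : ℝ} {L : ℝ} (hs : 0 ≤ s) (hφ : 0 < φ) (hφL : φ ≤ L)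
    {t : ℝ} (ht : |t| ≤ Real.sqrt s * w) :
    4 / L * (((1 + s)⁻¹) ^ 2 * v ^ 2) - w ^ 2 ≤
      (2 * (2 / ((1 + s) * φ)) + 2 * s * (-2 * (φ - 1) / ((1 + s) * φ) ^ 2)) * v ^ 2
        + 2 * (2 / ((1 + s) * φ)) * (v * t) := by
  have h1 : 0 < 1 + s := by positivity
  set F := 2 / ((1 + s) * φ) with hF
  have hF0 : 0 < F := by positivity
  have e1 : 2 * F + 2 * s * (-2 * (φ - 1) / ((1 + s) * φ) ^ 2)
      = 4 / φ * ((1 + s)⁻¹) ^ 2 + F ^ 2 * s := by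
    rw [hF]
    field_simp
    ring
  rw [e1]
  have h2 : 4 / L ≤ 4 / φ := div_le_div_of_nonneg_left (by norm_num) hφ hφL
  have h3 : 4 / L * (((1 + s)⁻¹) ^ 2 * v ^ 2) ≤ 4 / φ * (((1 + s)⁻¹) ^ 2 * v ^ 2) :=
    mul_le_mul_of_nonneg_right h2 (by positivity)
  have h4 : |F * v * t| ≤ (F * |v| * Real.sqrt s) * w := by
    rw [abs_mul, abs_mul, abs_of_pos hF0]
    calc F * |v| * |t| ≤ F * |v| * (Real.sqrt s * w) := by gcongr
      _ = _ := by ring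
  have h5 := neg_le_of_abs_le h4
  have h6 : (F * |v| * Real.sqrt s) ^ 2 = F ^ 2 * s * v ^ 2 := by
    rw [mul_pow, mul_pow, sq_abs, Real.sq_sqrt hs]
    ring
  nlinarith [sq_nonneg (F * |v| * Real.sqrt s - w)]

/-- A logarithmic Hardy inequality in the plane. -/
theorem HasWeakGradient.hardy {v : L2 ℝ} {g : L2 Plane} (h : HasWeakGradient v g) {ρ : ℝ}
    (hρ : 0 ≤ ρ) (hv : SupportedIn ρ v) :
    ‖scal ℝ (fun x => (1 + ‖x‖ ^ 2)⁻¹) v‖ ^ 2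
      ≤ (1 + Real.log (1 + (2 * (ρ + 1)) ^ 2)) / 4 * ‖g‖ ^ 2 := by
  obtain ⟨C, -, hC⟩ := exists_cutoff
  obtain ⟨χ, h1, -, h3, h4, -⟩ := hC (ρ + 1) (by linarith)
  -- The choice of `L` makes `L - log (1 + |x|²)` at least `1` on the ball containing the support of
  -- `χ`, so the profile is smooth there.
  set L := 1 + Real.log (1 + (2 * (ρ + 1)) ^ 2) with hL
  have hL1 : 1 ≤ L := by
    rw [hL]
    have : 0 ≤ Real.log (1 + (2 * (ρ + 1)) ^ 2) :=
      Real.log_nonneg (by nlinarith [sq_nonneg (2 * (ρ + 1))])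
    linarith
  set q : ℝ → ℝ := fun s => 2 / ((1 + s) * (L - Real.log (1 + s))) with hq
  have hpos : ∀ x : Plane, ‖x‖ ≤ 2 * (ρ + 1) → 0 < L - Real.log (1 + ‖x‖ ^ 2) := by
    intro x hx
    have : Real.log (1 + ‖x‖ ^ 2) ≤ Real.log (1 + (2 * (ρ + 1)) ^ 2) := by
      refine Real.log_le_log (by positivity) ?_
      gcongr
    rw [hL]
    linarith
  set ψ : Plane → ℝ := fun x => q (‖x‖ ^ 2) * χ x with hψdef
  have hψ : IsTestFunction ψ := by
    refine ⟨contDiff_iff_contDiffAt.2 fun x => ?_, h1.2.mul_left⟩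
    by_cases hx : ‖x‖ ≤ 2 * (ρ + 1)
    · have hn : ContDiffAt ℝ ∞ (fun y : Plane => 1 + ‖y‖ ^ 2) x :=
        contDiffAt_const.add (contDiff_norm_sq ℝ).contDiffAt
      have hlog : ContDiffAt ℝ ∞ (fun y : Plane => Real.log (1 + ‖y‖ ^ 2)) x :=
        hn.log (by positivity)
      exact (contDiffAt_const.div (hn.mul (contDiffAt_const.sub hlog))
        (mul_ne_zero (by positivity) (hpos x hx).ne')).mul h1.1.contDiffAt
    · refine (contDiffAt_const (c := (0 : ℝ))).congr_of_eventuallyEq ?_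
      have : {y : Plane | 2 * (ρ + 1) < ‖y‖} ∈ 𝓝 x :=
        (isOpen_lt continuous_const continuous_norm).mem_nhds (not_le.1 hx)
      filter_upwards [this] with y hy
      simp only [hψdef]
      rw [h4 y (le_of_lt hy), mul_zero]
  have hψval : ∀ x : Plane, ‖x‖ ≤ ρ → ψ x = q (‖x‖ ^ 2) := fun x hx => by
    simp only [hψdef]
    rw [h3 x (by linarith), mul_one]
  have hψgrad : ∀ x : Plane, ‖x‖ ≤ ρ → inner ℝ x (gradient ψ x) = 2 * ‖x‖ ^ 2 *
      (-2 * (L - Real.log (1 + ‖x‖ ^ 2) - 1) /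
        ((1 + ‖x‖ ^ 2) * (L - Real.log (1 + ‖x‖ ^ 2))) ^ 2) := by
    intro x hx
    have hev : ψ =ᶠ[𝓝 x] fun y => q (‖y‖ ^ 2) := by
      have : Metric.ball (0 : Plane) (ρ + 1) ∈ 𝓝 x :=
        Metric.isOpen_ball.mem_nhds (by rw [mem_ball_zero_iff]; linarith)
      filter_upwards [this] with y hy
      simp only [hψdef]
      rw [h3 y (mem_ball_zero_iff.1 hy).le, mul_one]
    rw [hev.gradient_eq, gradient_comp_real (T := q) (φ := fun y : Plane => ‖y‖ ^ 2)
      (hasDerivAt_hardyProfile (sq_nonneg ‖x‖) (hpos x (by linarith)))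
      ((contDiff_norm_sq ℝ (n := 1)).differentiable (by simp) x), gradient_norm_sq,
      inner_smul_right, inner_smul_right, real_inner_self_eq_norm_sq]
    ring
  have key := h.integral_mul_radial hψ
  have hk : MemLp (fun x : Plane => 2 * ψ x + inner ℝ x (gradient ψ x)) ⊤
      (volume : Measure Plane) :=
    ((continuous_const.mul hψ.1.continuous).add hψ.continuous_radial).memLp_of_hasCompactSupport
      (hψ.2.mul_left.add hψ.hasCompactSupport_radial)
  have hX : MemLp (fun x : Plane => ψ x • x) ⊤ (volume : Measure Plane) :=
    (hψ.1.continuous.smul continuous_id).memLp_of_hasCompactSupport hψ.2.smul_right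
  have i1 : Integrable fun x => (2 * ψ x + inner ℝ x (gradient ψ x)) * v x ^ 2 := by
    simpa only [real_inner_self_eq_norm_sq, Real.norm_eq_abs, sq_abs]
      using integrable_mul_inner hk v v
  have i2 : Integrable fun x => ψ x * (v x * inner ℝ x (g x)) := by
    refine (integrable_mul_dot hX v g).congr (Eventually.of_forall fun x => ?_)
    simp only [inner_smul_left, conj_trivial]
    ring
  have i3 := integrable_norm_sq_L2 (scal ℝ (fun x => (1 + ‖x‖ ^ 2)⁻¹) v)
  have i4 := integrable_norm_sq_L2 g
  -- The right-hand side is zero by `key`, so integrating the pointwise bound is all that is left.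
  have main : ∫ x, (4 / L * ‖scal ℝ (fun x => (1 + ‖x‖ ^ 2)⁻¹) v x‖ ^ 2 - ‖g x‖ ^ 2)
      ≤ ∫ x, ((2 * ψ x + inner ℝ x (gradient ψ x)) * v x ^ 2
        + 2 * (ψ x * (v x * inner ℝ x (g x)))) := by
    refine integral_mono_ae ((i3.const_mul _).sub i4) (i1.add (i2.const_mul _)) ?_
    filter_upwards [hv, coeFn_scal memLp_inv_one_add_norm_sq v] with x hx hx'
    rw [hx', smul_eq_mul, norm_mul, mul_pow, Real.norm_of_nonneg (r := (1 + ‖x‖ ^ 2)⁻¹)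
      (by positivity), Real.norm_eq_abs, sq_abs]
    by_cases hxρ : ‖x‖ ≤ ρ
    · rw [hψval x hxρ, hψgrad x hxρ]
      have hlog : 0 ≤ Real.log (1 + ‖x‖ ^ 2) :=
        Real.log_nonneg (by nlinarith [sq_nonneg ‖x‖])
      refine (hardy_pointwise (sq_nonneg ‖x‖) (hpos x (by linarith)) (by linarith)
        (w := ‖g x‖) (t := inner ℝ x (g x)) (v := v x) ?_).trans (le_of_eq ?_)
      · rw [Real.sqrt_sq (norm_nonneg x)]
        exact abs_real_inner_le_norm _ _
      · simp only [hq]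
        ring
    · rw [hx (not_le.1 hxρ)]
      simp only [ne_eq, OfNat.ofNat_ne_zero, not_false_eq_true, zero_pow, mul_zero, zero_mul]
      nlinarith [sq_nonneg ‖g x‖]
  rw [integral_add i1 (i2.const_mul _), integral_const_mul, key,
    integral_sub (i3.const_mul _) i4, integral_const_mul, ← norm_sq_L2, ← norm_sq_L2] at main
  have hLpos : 0 < L := by linarith
  have : 4 / L * ‖scal ℝ (fun x => (1 + ‖x‖ ^ 2)⁻¹) v‖ ^ 2 ≤ ‖g‖ ^ 2 := by linarith
  rw [div_mul_eq_mul_div, div_le_iff₀ hLpos] at this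
  linarith

/-! ### Support conditions in `L²`. -/

namespace SupportedIn

variable {E : Type} [NormedAddCommGroup E] {M : ℝ}

theorem mono {f : L2 E} {M' : ℝ} (h : SupportedIn M f) (hM : M ≤ M') : SupportedIn M' f := by
  filter_upwards [h] with x hx hM'
  exact hx (hM.trans_lt hM')

variable [NormedSpace ℝ E]

theorem memLp_indicator_compl_ball (M : ℝ) :
    MemLp ((Metric.closedBall (0 : Plane) M)ᶜ.indicator fun _ => (1 : ℝ)) ⊤
      (volume : Measure Plane) :=
  (memLp_const_top (1 : ℝ)).indicator Metric.isClosed_closedBall.measurableSet.compl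

/-- Restriction to the complement of a ball. -/
noncomputable def restrictCompl (E : Type) [NormedAddCommGroup E] [NormedSpace ℝ E] (M : ℝ) :
    L2 E →L[ℝ] L2 E :=
  scal E ((Metric.closedBall (0 : Plane) M)ᶜ.indicator fun _ => (1 : ℝ))

/-- The support condition is the kernel of a bounded operator, hence stable under sums, multiples
and time integrals. -/
theorem iff_restrictCompl {f : L2 E} : SupportedIn M f ↔ restrictCompl E M f = 0 := by
  have h := coeFn_scal (memLp_indicator_compl_ball M) f
  rw [Lp.ext_iff]
  constructor
  · intro hf
    filter_upwards [h, hf, Lp.coeFn_zero E 2 (volume : Measure Plane)] with x h1 h2 h3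
    rw [h3]
    refine h1.trans ?_
    by_cases hx : x ∈ Metric.closedBall (0 : Plane) M
    · rw [Set.indicator_of_notMem (by simpa using hx), zero_smul]
      rfl
    · rw [h2 (by simpa using hx), smul_zero]
      rfl
  · intro hf
    filter_upwards [h, hf, Lp.coeFn_zero E 2 (volume : Measure Plane)] with x h1 h2 h3 hx
    have h4 := h1.symm.trans (h2.trans h3)
    rw [Set.indicator_of_mem (by simpa using hx), one_smul] at h4
    exact h4

theorem add {f g : L2 E} (hf : SupportedIn M f) (hg : SupportedIn M g) :
    SupportedIn M (f + g) := by
  rw [iff_restrictCompl] at *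
  rw [map_add, hf, hg, add_zero]

theorem smul {f : L2 E} (hf : SupportedIn M f) (c : ℝ) : SupportedIn M (c • f) := by
  rw [iff_restrictCompl] at *
  rw [map_smul, hf, smul_zero]

theorem intervalIntegral [CompleteSpace E] {F : ℝ → L2 E} (hF : Continuous F) {a b : ℝ}
    (hab : a ≤ b) (h : ∀ t ∈ Set.Icc a b, SupportedIn M (F t)) :
    SupportedIn M (∫ t in a..b, F t) := by
  rw [iff_restrictCompl, ← (restrictCompl E M).intervalIntegral_comp_comm
    (hF.intervalIntegrable (μ := volume) a b)]
  rw [intervalIntegral.integral_congr (g := fun _ => 0), intervalIntegral.integral_zero]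
  intro t ht
  rw [Set.uIcc_of_le hab] at ht
  exact iff_restrictCompl.1 (h t ht)

end SupportedIn

/-! ### Weighted energy estimates for regular solutions. -/

/-- The energy with weight `w` of a state with velocity `p` and spatial gradient `g`. -/
noncomputable def weightedEnergy (K w : Plane → ℝ) (p : L2 ℝ) (g : L2 Plane) : ℝ :=
  (1 / 2) * (inner ℝ p (scal ℝ w p) + inner ℝ g (scal Plane (fun x => w x * K x) g))

theorem memLp_top_mul {w K : Plane → ℝ} (hw : MemLp w ⊤ (volume : Measure Plane))
    (hK : MemLp K ⊤ (volume : Measure Plane)) :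
    MemLp (fun x => w x * K x) ⊤ (volume : Measure Plane) := hK.mul hw

theorem integrable_energyDensity {K w : Plane → ℝ} (hw : MemLp w ⊤ (volume : Measure Plane))
    (hK : MemLp K ⊤ (volume : Measure Plane)) (p : L2 ℝ) (g : L2 Plane) :
    Integrable fun x => w x * (p x ^ 2 + K x * ‖g x‖ ^ 2) := by
  refine ((integrable_mul_inner hw p p).add
    (integrable_mul_inner (memLp_top_mul hw hK) g g)).congr (Eventually.of_forall fun x => ?_)
  simp only [Pi.add_apply, real_inner_self_eq_norm_sq, Real.norm_eq_abs, sq_abs]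
  ring

theorem weightedEnergy_eq {K w : Plane → ℝ} (hw : MemLp w ⊤ (volume : Measure Plane))
    (hK : MemLp K ⊤ (volume : Measure Plane)) (p : L2 ℝ) (g : L2 Plane) :
    weightedEnergy K w p g = (1 / 2) * ∫ x, w x * (p x ^ 2 + K x * ‖g x‖ ^ 2) := by
  rw [weightedEnergy, inner_scal hw, inner_scal (memLp_top_mul hw hK),
    ← integral_add (integrable_mul_inner hw p p) (integrable_mul_inner (memLp_top_mul hw hK) g g)]
  congr 1
  refine integral_congr_ae (Eventually.of_forall fun x => ?_)
  simp only [real_inner_self_eq_norm_sq, Real.norm_eq_abs, sq_abs]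
  ring

theorem Filter.Tendsto.weightedEnergy {α : Type*} {l : Filter α} {K w : Plane → ℝ}
    {p : α → L2 ℝ} {g : α → L2 Plane} {p' : L2 ℝ} {g' : L2 Plane} (hp : Tendsto p l (𝓝 p'))
    (hg : Tendsto g l (𝓝 g')) :
    Tendsto (fun s => weightedEnergy K w (p s) (g s)) l (𝓝 (weightedEnergy K w p' g')) :=
  ((hp.inner (((scal ℝ w).continuous.tendsto _).comp hp)).add
    (hg.inner (((scal Plane _).continuous.tendsto _).comp hg))).const_mul _

/-- A solution of `u_tt = ∇ ⬝ (K ∇u)` with `u ∈ C²((0, ∞); L²) ∩ C¹((0, ∞); H¹)`: here `p = u_t`,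
`a = u_tt`, `g = ∇u`, `q = ∇u_t`. -/
structure IsRegularSolution (K : Plane → ℝ) (u p a : ℝ → L2 ℝ) (g q : ℝ → L2 Plane) : Prop where
  continuous_u : Continuous u
  continuous_p : Continuous p
  continuous_g : Continuous g
  deriv_u : ∀ t, 0 < t → HasDerivAt u (p t) t
  deriv_p : ∀ t, 0 < t → HasDerivAt p (a t) t
  deriv_g : ∀ t, 0 < t → HasDerivAt g (q t) t
  weakGradient_u : ∀ t, 0 < t → HasWeakGradient (u t) (g t)
  weakGradient_p : ∀ t, 0 < t → HasWeakGradient (p t) (q t)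
  weakDivergence : ∀ t, 0 < t → IsWeakDivergence (a t) (scal Plane K (g t))

namespace IsRegularSolution

variable {K : Plane → ℝ} {u p a : ℝ → L2 ℝ} {g q : ℝ → L2 Plane}

/-- Testing the equation against `w u_t`, which is in `H¹` for a regular solution, cancels
everything but the flux through `∇w`. -/
theorem hasDerivAt_weightedEnergy (h : IsRegularSolution K u p a g q)
    (hK : MemLp K ⊤ (volume : Measure Plane)) {w : Plane → ℝ} (hw : ContDiff ℝ ∞ w)
    (hwb : MemLp w ⊤ (volume : Measure Plane))
    (hwb' : MemLp (gradient w) ⊤ (volume : Measure Plane)) {t : ℝ} (ht : 0 < t) :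
    HasDerivAt (fun s => weightedEnergy K w (p s) (g s))
      (-inner ℝ (scal Plane K (g t)) (vec (gradient w) (p t))) t := by
  have hp := h.deriv_p t ht
  have hg := h.deriv_g t ht
  have hp' := (scal ℝ w).hasFDerivAt.comp_hasDerivAt t hp
  have hg' := (scal Plane fun x => w x * K x).hasFDerivAt.comp_hasDerivAt t hg
  have hd := ((hp.inner ℝ hp').add (hg.inner ℝ hg')).const_mul (1 / 2)
  refine hd.congr_deriv ?_
  have e1 := (h.weakDivergence t ht).inner_eq ((h.weakGradient_p t ht).mul_smooth hw hwb hwb')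
  rw [inner_add_right] at e1
  have e2 : inner ℝ (p t) (scal ℝ w (a t)) = inner ℝ (a t) (scal ℝ w (p t)) := by
    rw [← inner_scal_left hwb, real_inner_comm]
  have e3 : inner ℝ (g t) (scal Plane (fun x => w x * K x) (q t))
      = inner ℝ (scal Plane K (g t)) (scal Plane w (q t)) := by
    rw [inner_scal_left hK, inner_L2, inner_L2]
    refine integral_congr_ae ?_
    filter_upwards [coeFn_scal (memLp_top_mul hwb hK) (q t), coeFn_scal hwb (q t),
      coeFn_scal hK (scal Plane w (q t))] with x h1 h2 h3
    rw [h1, h3, h2, smul_smul, mul_comm]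
  have e4 : inner ℝ (q t) (scal Plane (fun x => w x * K x) (g t))
      = inner ℝ (scal Plane K (g t)) (scal Plane w (q t)) := by
    rw [← e3, ← inner_scal_left (memLp_top_mul hwb hK), real_inner_comm]
  simp only [Function.comp]
  rw [e2, e3, e4, e1]
  ring

/-- The flux density is `√K |∇w|` times `|p| √K |g|`, and the second factor is at most the energy
density. Thus `κ` measures the growth of `log w` at the local wave speed `√K`. -/
theorem abs_inner_vec_gradient_le (hK : MemLp K ⊤ (volume : Measure Plane)) (hK0 : ∀ x, 0 ≤ K x)
    {w : Plane → ℝ} (hwb : MemLp w ⊤ (volume : Measure Plane))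
    (hwb' : MemLp (gradient w) ⊤ (volume : Measure Plane)) {κ : ℝ}
    (hκ : ∀ x, Real.sqrt (K x) * ‖gradient w x‖ ≤ κ * w x) (p : L2 ℝ) (g : L2 Plane) :
    |inner ℝ (scal Plane K g) (vec (gradient w) p)| ≤ κ * weightedEnergy K w p g := by
  rw [real_inner_comm, inner_vec hwb', weightedEnergy_eq hwb hK, mul_left_comm,
    ← integral_const_mul, ← integral_const_mul]
  refine (abs_integral_le_integral_abs).trans (integral_mono_ae
    (integrable_mul_dot hwb' p (scal Plane K g)).abs
    (((integrable_energyDensity hwb hK p g).const_mul κ).const_mul _) ?_)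
  filter_upwards [coeFn_scal hK g] with x hx
  rw [hx, inner_smul_right, abs_mul, abs_mul, abs_of_nonneg (hK0 x)]
  set s := Real.sqrt (K x)
  have hs : K x = s ^ 2 := (Real.sq_sqrt (hK0 x)).symm
  have hs0 : 0 ≤ s := Real.sqrt_nonneg _
  have h1 : |inner ℝ (gradient w x) (g x)| ≤ ‖gradient w x‖ * ‖g x‖ := abs_real_inner_le_norm _ _
  rw [hs]
  calc |p x| * (s ^ 2 * |inner ℝ (gradient w x) (g x)|)
      ≤ |p x| * (s ^ 2 * (‖gradient w x‖ * ‖g x‖)) := by gcongr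
    _ = (s * ‖gradient w x‖) * (|p x| * (s * ‖g x‖)) := by ring
    _ ≤ (κ * w x) * (|p x| * (s * ‖g x‖)) := by
      refine mul_le_mul_of_nonneg_right (hκ x) (by positivity)
    _ ≤ (κ * w x) * (1 / 2 * (p x ^ 2 + s ^ 2 * ‖g x‖ ^ 2)) := by
      refine mul_le_mul_of_nonneg_left ?_ ((by positivity : 0 ≤ s * ‖gradient w x‖).trans (hκ x))
      nlinarith [sq_nonneg (|p x| - s * ‖g x‖), sq_abs (p x)]
    _ = _ := by ring

theorem weightedEnergy_le (h : IsRegularSolution K u p a g q)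
    (hK : MemLp K ⊤ (volume : Measure Plane)) (hK0 : ∀ x, 0 ≤ K x)
    {w : Plane → ℝ} (hw : ContDiff ℝ ∞ w) (hwb : MemLp w ⊤ (volume : Measure Plane))
    (hwb' : MemLp (gradient w) ⊤ (volume : Measure Plane)) {κ : ℝ}
    (hκ : ∀ x, Real.sqrt (K x) * ‖gradient w x‖ ≤ κ * w x) {t : ℝ} (ht : 0 ≤ t) :
    weightedEnergy K w (p t) (g t) ≤ Real.exp (κ * t) * weightedEnergy K w (p 0) (g 0) := by
  set e : ℝ → ℝ := fun s => weightedEnergy K w (p s) (g s) with he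
  have hcont : Continuous fun s => Real.exp (-(κ * s)) * e s := by
    refine Continuous.mul (by fun_prop) (continuous_iff_continuousAt.2 fun s => ?_)
    exact Filter.Tendsto.weightedEnergy h.continuous_p.continuousAt h.continuous_g.continuousAt
  have hder : ∀ s, 0 < s → HasDerivAt (fun s => Real.exp (-(κ * s)) * e s)
      (Real.exp (-(κ * s)) * (-(κ * 1)) * e s + Real.exp (-(κ * s)) *
        (-inner ℝ (scal Plane K (g s)) (vec (gradient w) (p s)))) s := fun s hs =>
    ((((hasDerivAt_id s).const_mul κ).neg).exp).mul (h.hasDerivAt_weightedEnergy hK hw hwb hwb' hs)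
  have hanti : AntitoneOn (fun s => Real.exp (-(κ * s)) * e s) (Set.Ici 0) := by
    refine antitoneOn_of_deriv_nonpos (convex_Ici 0) hcont.continuousOn ?_ ?_
    · intro s hs
      rw [interior_Ici] at hs
      exact (hder s hs).differentiableAt.differentiableWithinAt
    · intro s hs
      rw [interior_Ici] at hs
      rw [(hder s hs).deriv]
      have := neg_le_of_abs_le (abs_inner_vec_gradient_le hK hK0 hwb hwb' hκ (p s) (g s))
      have hexp := Real.exp_pos (-(κ * s))
      have : Real.exp (-(κ * s)) * (-inner ℝ (scal Plane K (g s)) (vec (gradient w) (p s)))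
          ≤ Real.exp (-(κ * s)) * (κ * e s) := mul_le_mul_of_nonneg_left (by linarith) hexp.le
      linarith
  have := hanti Set.self_mem_Ici (Set.mem_Ici.2 ht) ht
  simp only [mul_zero, neg_zero, Real.exp_zero, one_mul] at this
  rw [Real.exp_neg, inv_mul_le_iff₀ (Real.exp_pos _)] at this
  exact this

end IsRegularSolution

/-! ### Mild solutions and regularization by averaging in time. -/

/-- Time-integrated form of the weak wave equation, for fields continuous in time. -/
structure IsMildSolution (K : Plane → ℝ) (u p : ℝ → L2 ℝ) (g : ℝ → L2 Plane) : Prop where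
  continuous_u : Continuous u
  continuous_p : Continuous p
  continuous_g : Continuous g
  weakGradient : ∀ t, HasWeakGradient (u t) (g t)
  sub_eq_integral : ∀ a b, 0 ≤ a → a ≤ b → u b - u a = ∫ t in a..b, p t
  weakDivergence : ∀ a b, 0 ≤ a → a ≤ b →
    IsWeakDivergence (p b - p a) (scal Plane K (∫ t in a..b, g t))

/-- The Steklov average of `F` over `[t, t + h]`. -/
noncomputable def steklov {E : Type} [NormedAddCommGroup E] [NormedSpace ℝ E] (h : ℝ)
    (F : ℝ → E) (t : ℝ) : E :=
  h⁻¹ • ∫ s in t..(t + h), F s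

section Steklov

variable {E : Type} [NormedAddCommGroup E] [NormedSpace ℝ E] {F : ℝ → E}

theorem steklov_eq (hF : Continuous F) (h t : ℝ) :
    steklov h F t = h⁻¹ • ((∫ s in (0)..(t + h), F s) - ∫ s in (0)..t, F s) := by
  rw [steklov, intervalIntegral.integral_interval_sub_left (hF.intervalIntegrable _ _)
    (hF.intervalIntegrable _ _)]

variable [CompleteSpace E]

theorem hasDerivAt_steklov (hF : Continuous F) (h t : ℝ) :
    HasDerivAt (steklov h F) (h⁻¹ • (F (t + h) - F t)) t := by
  have h1 := (hF.integral_hasStrictDerivAt 0 (t + h)).hasDerivAt.comp_add_const t h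
  have h2 := (hF.integral_hasStrictDerivAt 0 t).hasDerivAt
  exact ((h1.sub h2).const_smul h⁻¹).congr_of_eventuallyEq
    (Eventually.of_forall fun s => steklov_eq hF h s)

theorem continuous_steklov (hF : Continuous F) (h : ℝ) : Continuous (steklov h F) :=
  continuous_iff_continuousAt.2 fun t => (hasDerivAt_steklov hF h t).continuousAt

theorem tendsto_steklov (hF : Continuous F) (t : ℝ) :
    Tendsto (fun h => steklov h F t) (𝓝[>] 0) (𝓝 (F t)) := by
  simp_rw [steklov_eq hF]
  exact (hF.integral_hasStrictDerivAt 0 t).hasDerivAt.tendsto_slope_zero_right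

end Steklov

theorem SupportedIn.steklov {E : Type} [NormedAddCommGroup E] [NormedSpace ℝ E] [CompleteSpace E]
    {F : ℝ → L2 E} (hF : Continuous F) {h t M : ℝ} (hh : 0 ≤ h)
    (hs : ∀ s ∈ Set.Icc t (t + h), SupportedIn M (F s)) : SupportedIn M (steklov h F t) :=
  (SupportedIn.intervalIntegral hF (by linarith) hs).smul _

/-- The coefficients do not depend on time, so averaging preserves the equation. The averaged
velocity is a difference quotient of `u`, hence in `H¹`, and the averaged acceleration is a
difference quotient of `p`. -/
theorem IsMildSolution.regular {K : Plane → ℝ} {u p : ℝ → L2 ℝ} {g : ℝ → L2 Plane}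
    (hu : IsMildSolution K u p g) {h : ℝ} (hh : 0 < h) :
    IsRegularSolution K (steklov h u) (steklov h p) (fun t => h⁻¹ • (p (t + h) - p t))
      (steklov h g) (fun t => h⁻¹ • (g (t + h) - g t)) where
  continuous_u := continuous_steklov hu.continuous_u h
  continuous_p := continuous_steklov hu.continuous_p h
  continuous_g := continuous_steklov hu.continuous_g h
  deriv_u t ht := by
    have := hasDerivAt_steklov hu.continuous_u h t
    rwa [hu.sub_eq_integral t (t + h) ht.le (by linarith)] at this
  deriv_p t _ := hasDerivAt_steklov hu.continuous_p h t
  deriv_g t _ := hasDerivAt_steklov hu.continuous_g h t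
  weakGradient_u t _ := (HasWeakGradient.intervalIntegral hu.continuous_u hu.continuous_g
    hu.weakGradient _ _).smul _
  weakGradient_p t ht := by
    rw [steklov, ← hu.sub_eq_integral t (t + h) ht.le (by linarith)]
    exact ((hu.weakGradient _).sub (hu.weakGradient _)).smul _
  weakDivergence t ht := by
    rw [steklov, map_smul]
    exact (hu.weakDivergence t (t + h) ht.le (by linarith)).smul _

/-- The integrated equation follows from the fundamental theorem of calculus. Freezing the fields at
their initial values for negative times makes them continuous on the whole line. -/
theorem IsWaveSolution.mild {K u₀ u₁ : Plane → ℝ} {u ut : ℝ → L2 ℝ} {gradu : ℝ → L2 Plane}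
    (hKb : MemLp K ⊤ (volume : Measure Plane))
    (hu : IsWaveSolution K u₀ u₁ u ut gradu) :
    IsMildSolution K (fun t => u (max t 0)) (fun t => ut (max t 0)) (fun t => gradu (max t 0)) := by
  have hext : ∀ {E : Type} [NormedAddCommGroup E] {F : ℝ → E}, ContinuousOn F (Set.Ici 0) →
      Continuous fun t => F (max t 0) := fun hF =>
    hF.comp_continuous (continuous_id.max continuous_const) fun t =>
      Set.mem_Ici.2 (le_max_right _ _)
  have cu : ContinuousOn u (Set.Ici 0) := fun t ht => (hu.hasDeriv t ht).continuousWithinAt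
  have cp := hext hu.continuousOn_ut
  have cg := hext hu.continuousOn_gradu
  refine ⟨hext cu, cp, cg, fun t => hu.weakGradient _ (le_max_right _ _), ?_, ?_⟩
  · intro a b ha hab
    rw [intervalIntegral.integral_eq_sub_of_hasDeriv_right_of_le hab (hext cu).continuousOn ?_
      (cp.intervalIntegrable _ _)]
    intro t ht
    have ht0 : 0 < t := ha.trans_lt ht.1
    have hd : HasDerivAt u (ut t) t := (hu.hasDeriv t ht0.le).hasDerivAt (Ici_mem_nhds ht0)
    have hd' : HasDerivAt (fun t => u (max t 0)) (ut (max t 0)) t := by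
      rw [max_eq_left ht0.le]
      refine hd.congr_of_eventuallyEq ?_
      filter_upwards [Ioi_mem_nhds ht0] with s hs
      rw [max_eq_left (le_of_lt hs)]
    exact hd'.hasDerivWithinAt
  · intro a b ha hab φ hφ
    have hy : ∀ t, 0 < t → HasDerivAt (fun s => inner ℝ hφ.toL2 (ut (max s 0)))
        (-inner ℝ hφ.gradL2 (scal Plane K (gradu (max t 0)))) t := by
      intro t ht
      have hd := hu.equation φ hφ t ht
      have e1 : ∫ x, K x * inner ℝ (gradu t x) (gradient φ x)
          = inner ℝ hφ.gradL2 (scal Plane K (gradu (max t 0))) := by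
        rw [max_eq_left ht.le, inner_scal hKb]
        refine integral_congr_ae ?_
        filter_upwards [hφ.coeFn_gradL2] with x hx
        rw [hx, real_inner_comm]
      rw [e1] at hd
      refine hd.congr_of_eventuallyEq ?_
      filter_upwards [Ioi_mem_nhds ht] with s hs
      rw [max_eq_left (le_of_lt hs), inner_L2]
      refine integral_congr_ae ?_
      filter_upwards [hφ.coeFn_toL2] with x hx
      rw [hx]
      simp
    have hc : Continuous fun t => -inner ℝ hφ.gradL2 (scal Plane K (gradu (max t 0))) :=
      (continuous_const.inner ((scal Plane K).continuous.comp cg)).neg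
    have := intervalIntegral.integral_eq_sub_of_hasDeriv_right_of_le hab
      (continuous_const.inner cp).continuousOn
      (fun t ht => (hy t (ha.trans_lt ht.1)).hasDerivWithinAt) (hc.intervalIntegrable _ _)
    rw [inner_sub_right, ← this, intervalIntegral.integral_neg]
    have h2 := ((innerSL ℝ hφ.gradL2).comp (scal Plane K)).intervalIntegral_comp_comm
      (cg.intervalIntegrable (μ := volume) a b)
    simp only [ContinuousLinearMap.comp_apply, innerSL_apply_apply] at h2
    rw [h2]

theorem memLp_top_one : MemLp (fun _ : Plane => (1 : ℝ)) ⊤ (volume : Measure Plane) :=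
  memLp_const_top 1

/-- Both sides are continuous in the `L²` fields, so the estimate passes to the limit from Steklov
averages. -/
theorem IsMildSolution.weightedEnergy_le {K : Plane → ℝ} {u p : ℝ → L2 ℝ} {g : ℝ → L2 Plane}
    (hu : IsMildSolution K u p g)
    (hK : MemLp K ⊤ (volume : Measure Plane)) (hK0 : ∀ x, 0 ≤ K x)
    {w : Plane → ℝ} (hw : ContDiff ℝ ∞ w) (hwb : MemLp w ⊤ (volume : Measure Plane))
    (hwb' : MemLp (gradient w) ⊤ (volume : Measure Plane)) {κ : ℝ}
    (hκ : ∀ x, Real.sqrt (K x) * ‖gradient w x‖ ≤ κ * w x) {t : ℝ} (ht : 0 ≤ t) :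
    weightedEnergy K w (p t) (g t) ≤ Real.exp (κ * t) * weightedEnergy K w (p 0) (g 0) := by
  refine le_of_tendsto_of_tendsto
    ((tendsto_steklov hu.continuous_p t).weightedEnergy (tendsto_steklov hu.continuous_g t))
    (((tendsto_steklov hu.continuous_p 0).weightedEnergy
      (tendsto_steklov hu.continuous_g 0)).const_mul _) ?_
  filter_upwards [self_mem_nhdsWithin] with h hh
  exact (hu.regular hh).weightedEnergy_le hK hK0 hw hwb hwb' hκ ht

theorem IsMildSolution.energy_le {K : Plane → ℝ} {u p : ℝ → L2 ℝ} {g : ℝ → L2 Plane}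
    (hu : IsMildSolution K u p g)
    (hK : MemLp K ⊤ (volume : Measure Plane)) (hK0 : ∀ x, 0 ≤ K x) {t : ℝ} (ht : 0 ≤ t) :
    weightedEnergy K (fun _ => 1) (p t) (g t) ≤ weightedEnergy K (fun _ => 1) (p 0) (g 0) := by
  have hg : gradient (fun _ : Plane => (1 : ℝ)) = fun _ => 0 := gradient_fun_const' 1
  have := hu.weightedEnergy_le hK hK0 (w := fun _ => 1) (κ := 0) contDiff_const memLp_top_one
    (by rw [hg]; exact memLp_const_top (0 : Plane)) (fun x => by rw [hg]; simp) ht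
  simpa using this

/-! ### Finite speed of propagation. -/

/-- If all exponential moments of `D ≥ 0` grow at most like `exp (μ a)`, then `D = 0` almost
everywhere on `{θ > a}`. -/
theorem ae_eq_zero_of_exp_moment_le {D θ : Plane → ℝ} (hD : Integrable D) (hD0 : ∀ x, 0 ≤ D x)
    (hθ : Continuous θ) {a C : ℝ}
    (hi : ∀ μ : ℝ, 0 < μ → Integrable fun x => Real.exp (μ * θ x) * D x)
    (h : ∀ μ : ℝ, 0 < μ → ∫ x, Real.exp (μ * θ x) * D x ≤ Real.exp (μ * a) * C) :
    ∀ᵐ x, a < θ x → D x = 0 := by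
  have key : ∀ n : ℕ, ∀ᵐ x, a + 1 / (n + 1 : ℝ) ≤ θ x → D x = 0 := by
    intro n
    set δ : ℝ := 1 / (n + 1 : ℝ) with hδ
    have hδ0 : 0 < δ := by positivity
    set S : Set Plane := {x | a + δ ≤ θ x} with hS
    have hSm : MeasurableSet S := (isClosed_le continuous_const hθ).measurableSet
    -- Chebyshev: on `S` the weight is at least `exp (μ (a + δ))`, which beats the assumed growth by
    -- `exp (μ δ)`.
    have hle : ∀ μ : ℝ, 0 < μ → ∫ x in S, D x ≤ Real.exp (-(μ * δ)) * C := by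
      intro μ hμ
      have h1 : Real.exp (μ * (a + δ)) * ∫ x in S, D x ≤ ∫ x in S, Real.exp (μ * θ x) * D x := by
        rw [← integral_const_mul]
        refine setIntegral_mono_on (hD.integrableOn.const_mul _) (hi μ hμ).integrableOn hSm ?_
        intro x hx
        refine mul_le_mul_of_nonneg_right (Real.exp_le_exp.2 ?_) (hD0 x)
        exact mul_le_mul_of_nonneg_left hx hμ.le
      have h2 : ∫ x in S, Real.exp (μ * θ x) * D x ≤ ∫ x, Real.exp (μ * θ x) * D x :=
        setIntegral_le_integral (hi μ hμ)
          (Eventually.of_forall fun x => mul_nonneg (Real.exp_pos _).le (hD0 x))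
      have h3 := (h1.trans h2).trans (h μ hμ)
      have h4 : Real.exp (-(μ * δ)) * C
          = (Real.exp (μ * (a + δ)))⁻¹ * (Real.exp (μ * a) * C) := by
        rw [← Real.exp_neg, ← mul_assoc, ← Real.exp_add]
        congr 2
        ring
      rw [h4, le_inv_mul_iff₀ (Real.exp_pos _)]
      exact h3
    have hlim : Tendsto (fun μ : ℝ => Real.exp (-(μ * δ)) * C) atTop (𝓝 0) := by
      have : Tendsto (fun μ : ℝ => μ * δ) atTop atTop := tendsto_id.atTop_mul_const hδ0
      simpa using (Real.tendsto_exp_neg_atTop_nhds_zero.comp this).mul_const C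
    have hz : ∫ x in S, D x ≤ 0 := by
      refine ge_of_tendsto hlim ?_
      filter_upwards [eventually_gt_atTop 0] with μ hμ
      exact hle μ hμ
    have hz' : ∫ x in S, D x = 0 := le_antisymm hz (integral_nonneg fun x => hD0 x)
    rw [setIntegral_eq_zero_iff_of_nonneg_ae (Eventually.of_forall fun x => hD0 x)
      hD.integrableOn] at hz'
    exact (ae_restrict_iff' hSm).1 hz'
  filter_upwards [ae_all_iff.2 key] with x hx hax
  obtain ⟨n, hn⟩ := exists_nat_one_div_lt (sub_pos.2 hax)
  exact hx n (by linarith)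

/-- A smooth bounded approximation of the distance to the origin. -/
noncomputable def boundedNorm (A ε : ℝ) (x : Plane) : ℝ :=
  ε⁻¹ * Real.arctan (ε * Real.sqrt (A ^ 2 + ‖x‖ ^ 2))

theorem arctan_le_self {z : ℝ} (hz : 0 ≤ z) : Real.arctan z ≤ z := by
  have := Real.le_tan (Real.arctan_nonneg.2 hz) (Real.arctan_lt_pi_div_two z)
  rwa [Real.tan_arctan] at this

section BoundedNorm

variable {A ε : ℝ}

theorem contDiff_boundedNorm (hA : 0 < A) : ContDiff ℝ ∞ (boundedNorm A ε) := by
  have h1 : ContDiff ℝ ∞ fun x : Plane => Real.sqrt (A ^ 2 + ‖x‖ ^ 2) :=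
    (contDiff_const.add (contDiff_norm_sq ℝ)).sqrt
      fun x => ne_of_gt (show 0 < A ^ 2 + ‖x‖ ^ 2 by positivity)
  exact contDiff_const.mul (Real.contDiff_arctan.comp (contDiff_const.mul h1))

theorem abs_boundedNorm_le (hε : 0 < ε) (x : Plane) : |boundedNorm A ε x| ≤ ε⁻¹ * (Real.pi / 2) := by
  rw [boundedNorm, abs_mul, abs_of_pos (inv_pos.2 hε)]
  refine mul_le_mul_of_nonneg_left ?_ (inv_pos.2 hε).le
  exact abs_le.2 ⟨(Real.neg_pi_div_two_lt_arctan _).le, (Real.arctan_lt_pi_div_two _).le⟩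

theorem boundedNorm_le (hε : 0 < ε) (x : Plane) :
    boundedNorm A ε x ≤ Real.sqrt (A ^ 2 + ‖x‖ ^ 2) := by
  rw [boundedNorm, inv_mul_le_iff₀ hε]
  exact arctan_le_self (by positivity)

theorem tendsto_boundedNorm (x : Plane) :
    Tendsto (fun ε => boundedNorm A ε x) (𝓝[>] 0) (𝓝 (Real.sqrt (A ^ 2 + ‖x‖ ^ 2))) := by
  set r := Real.sqrt (A ^ 2 + ‖x‖ ^ 2)
  have h1 : HasDerivAt (fun ε : ℝ => Real.arctan (ε * r)) r 0 := by
    have h2 : HasDerivAt (fun ε : ℝ => ε * r) (1 * r) 0 := (hasDerivAt_id 0).mul_const r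
    simpa using h2.arctan
  simpa [boundedNorm] using h1.tendsto_slope_zero_right

theorem norm_gradient_boundedNorm_le (hA : 0 < A) (hε : 0 < ε) (x : Plane) :
    ‖gradient (boundedNorm A ε) x‖ ≤ ‖x‖ / Real.sqrt (A ^ 2 + ‖x‖ ^ 2) := by
  have hpos : 0 < A ^ 2 + ‖x‖ ^ 2 := by positivity
  have h1 : HasDerivAt (fun s : ℝ => A ^ 2 + s) 1 (‖x‖ ^ 2) := (hasDerivAt_id _).const_add _
  have h2 := ((h1.sqrt hpos.ne').const_mul ε).arctan.const_mul ε⁻¹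
  have h3 := gradient_comp_real (φ := fun y : Plane => ‖y‖ ^ 2) h2
    ((contDiff_norm_sq ℝ (n := 1)).differentiable (by simp) x)
  change gradient (boundedNorm A ε) x = _ at h3
  set r := Real.sqrt (A ^ 2 + ‖x‖ ^ 2) with hr
  have hr0 : 0 < r := Real.sqrt_pos.2 hpos
  rw [h3, gradient_norm_sq, smul_smul, norm_smul, Real.norm_of_nonneg (by positivity)]
  have h4 : ε⁻¹ * (1 / (1 + (ε * r) ^ 2) * (ε * (1 / (2 * r)))) * 2
      = (1 / (1 + (ε * r) ^ 2)) / r := by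
    field_simp
  rw [h4, div_mul_eq_mul_div]
  refine div_le_div_of_nonneg_right ?_ hr0.le
  refine mul_le_of_le_one_left (norm_nonneg _) ?_
  rw [div_le_one (by positivity)]
  nlinarith [sq_nonneg (ε * r)]

end BoundedNorm

/-- Finite speed of propagation: outside the ball of radius `r₀` the speed is `√k₀`. -/
theorem IsMildSolution.finite_propagation {K : Plane → ℝ} {u p : ℝ → L2 ℝ} {g : ℝ → L2 Plane}
    (hu : IsMildSolution K u p g) {km k₀ r₀ C R₀ : ℝ} (hKc : Continuous K)
    (hKC : ∀ x, |K x| ≤ C) (hkm : 0 < km) (hK1 : ∀ x, km ≤ K x) (hk₀ : 0 < k₀)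
    (hK3 : ∀ x : Plane, r₀ < ‖x‖ → K x = k₀) (hp : SupportedIn R₀ (p 0))
    (hg : SupportedIn R₀ (g 0)) :
    ∃ ρ : ℝ, R₀ ≤ ρ ∧ 0 ≤ ρ ∧ ∀ t, 0 ≤ t →
      SupportedIn (ρ + Real.sqrt k₀ * t) (p t) ∧ SupportedIn (ρ + Real.sqrt k₀ * t) (g t) := by
  have hK : MemLp K ⊤ (volume : Measure Plane) := memLp_top_of_continuous hKc hKC
  have hK0 : ∀ x, 0 ≤ K x := fun x => hkm.le.trans (hK1 x)
  set c := Real.sqrt k₀ with hc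
  have hc0 : 0 < c := Real.sqrt_pos.2 hk₀
  -- This makes `√C |r₀| ≤ c A`: inside the ball of radius `r₀` waves may travel at speed up to
  -- `√C`, but there the slope of `√(A² + |x|²)` is at most `|r₀| / A`.
  set A := Real.sqrt C * |r₀| / c + 1 with hA
  have hA0 : 0 < A := by positivity
  -- The value of the untruncated weight function at radius `R₀`, bounding it on the support of the
  -- data.
  set ρ := Real.sqrt (A ^ 2 + R₀ ^ 2) with hρ
  refine ⟨ρ, (le_abs_self _).trans (Real.abs_le_sqrt (by nlinarith)), Real.sqrt_nonneg _, ?_⟩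
  have hslope : ∀ x : Plane, Real.sqrt (K x) * (‖x‖ / Real.sqrt (A ^ 2 + ‖x‖ ^ 2)) ≤ c := by
    intro x
    have hr0 : 0 < Real.sqrt (A ^ 2 + ‖x‖ ^ 2) := Real.sqrt_pos.2 (by positivity)
    rw [mul_div_assoc', div_le_iff₀ hr0]
    by_cases hx : r₀ < ‖x‖
    · rw [hK3 x hx]
      exact mul_le_mul_of_nonneg_left (Real.le_sqrt_of_sq_le (by nlinarith [sq_nonneg A])) hc0.le
    · have h1 : ‖x‖ ≤ |r₀| := (not_lt.1 hx).trans (le_abs_self _)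
      have h2 : Real.sqrt (K x) ≤ Real.sqrt C := Real.sqrt_le_sqrt ((le_abs_self _).trans (hKC x))
      have h3 : A ≤ Real.sqrt (A ^ 2 + ‖x‖ ^ 2) := Real.le_sqrt_of_sq_le (by nlinarith)
      have h4 : Real.sqrt C * |r₀| ≤ c * A := by
        rw [hA, mul_add, mul_div_cancel₀ _ hc0.ne']
        linarith
      calc Real.sqrt (K x) * ‖x‖ ≤ Real.sqrt C * |r₀| := by gcongr
        _ ≤ c * A := h4
        _ ≤ _ := by gcongr
  intro t ht
  set D : ℝ → Plane → ℝ := fun s x => p s x ^ 2 + K x * ‖g s x‖ ^ 2 with hD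
  have hDi : ∀ s, Integrable (D s) := fun s => by
    simpa only [one_mul] using integrable_energyDensity memLp_top_one hK (p s) (g s)
  have hD0 : ∀ s x, 0 ≤ D s x := fun s x =>
    add_nonneg (sq_nonneg _) (mul_nonneg (hK0 x) (sq_nonneg _))
  -- The arctangent keeps the exponential weights bounded; letting `ε → 0` afterwards recovers `√(A²
  -- + |x|²)`, which dominates `|x|`.
  have key : ∀ ε : ℝ, 0 < ε → ∀ᵐ x, ρ + c * t < boundedNorm A ε x → D t x = 0 := by
    intro ε hε
    have hθ := contDiff_boundedNorm (ε := ε) hA0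
    have hw : ∀ μ : ℝ, ContDiff ℝ ∞ fun x => Real.exp (μ * boundedNorm A ε x) := fun μ =>
      (contDiff_const.mul hθ).exp
    have hwb : ∀ μ : ℝ, 0 < μ → MemLp (fun x => Real.exp (μ * boundedNorm A ε x)) ⊤
        (volume : Measure Plane) := fun μ hμ => by
      refine memLp_top_of_continuous (hw μ).continuous
        (C := Real.exp (μ * (ε⁻¹ * (Real.pi / 2)))) fun x => ?_
      rw [Real.norm_of_nonneg (Real.exp_pos _).le]
      exact Real.exp_le_exp.2 (mul_le_mul_of_nonneg_left
        ((le_abs_self _).trans (abs_boundedNorm_le hε x)) hμ.le)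
    have hgrad : ∀ μ x, gradient (fun x => Real.exp (μ * boundedNorm A ε x)) x
        = (Real.exp (μ * boundedNorm A ε x) * (μ * 1)) • gradient (boundedNorm A ε) x := fun μ x =>
      gradient_comp_real (T := fun s => Real.exp (μ * s)) ((hasDerivAt_id _).const_mul μ).exp
        (hθ.differentiable (by simp) x)
    have hwb' : ∀ μ : ℝ, 0 < μ → MemLp (gradient fun x => Real.exp (μ * boundedNorm A ε x)) ⊤
        (volume : Measure Plane) := fun μ hμ => by
      refine memLp_top_of_continuous ((hw μ).continuous_gradient' (by simp))
        (C := Real.exp (μ * (ε⁻¹ * (Real.pi / 2))) * μ * 1) fun x => ?_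
      have hpos : 0 < A ^ 2 + ‖x‖ ^ 2 := by positivity
      rw [hgrad, mul_one, norm_smul, Real.norm_of_nonneg (by positivity)]
      refine mul_le_mul (mul_le_mul_of_nonneg_right (Real.exp_le_exp.2 (mul_le_mul_of_nonneg_left
        ((le_abs_self _).trans (abs_boundedNorm_le hε x)) hμ.le)) hμ.le) ?_ (norm_nonneg _)
        (by positivity)
      refine (norm_gradient_boundedNorm_le hA0 hε x).trans ?_
      rw [div_le_one (Real.sqrt_pos.2 hpos)]
      exact Real.le_sqrt_of_sq_le (by nlinarith)
    refine ae_eq_zero_of_exp_moment_le (hDi t) (hD0 t) hθ.continuous (C := ∫ x, D 0 x)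
      (fun μ hμ => integrable_energyDensity (hwb μ hμ) hK (p t) (g t)) fun μ hμ => ?_
    -- The weight `exp (μ θ)` with `√K |∇θ| ≤ c` has growth rate `κ = c μ`, so the support spreads
    -- at speed `c`, whatever `μ`.
    have h1 := hu.weightedEnergy_le hK hK0 (hw μ) (hwb μ hμ) (hwb' μ hμ) (κ := c * μ) (fun x => by
      rw [hgrad, mul_one, norm_smul, Real.norm_of_nonneg (by positivity)]
      have h2 := (mul_le_mul_of_nonneg_left (norm_gradient_boundedNorm_le hA0 hε x)
        (Real.sqrt_nonneg (K x))).trans (hslope x)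
      have h3 : 0 ≤ Real.exp (μ * boundedNorm A ε x) * μ := by positivity
      nlinarith [mul_le_mul_of_nonneg_left h2 h3]) ht
    rw [weightedEnergy_eq (hwb μ hμ) hK, weightedEnergy_eq (hwb μ hμ) hK] at h1
    have h2 : ∫ x, Real.exp (μ * boundedNorm A ε x) * (p 0 x ^ 2 + K x * ‖g 0 x‖ ^ 2)
        ≤ ∫ x, Real.exp (μ * ρ) * D 0 x := by
      refine integral_mono_ae (integrable_energyDensity (hwb μ hμ) hK (p 0) (g 0))
        ((hDi 0).const_mul _) ?_
      filter_upwards [hp, hg] with x hx hx'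
      by_cases hxR : ‖x‖ ≤ R₀
      · refine mul_le_mul_of_nonneg_right (Real.exp_le_exp.2 (mul_le_mul_of_nonneg_left ?_ hμ.le))
          (hD0 0 x)
        refine (boundedNorm_le hε x).trans (Real.sqrt_le_sqrt ?_)
        have := norm_nonneg x
        gcongr
      · simp [hD, hx (not_le.1 hxR), hx' (not_le.1 hxR)]
    rw [integral_const_mul] at h2
    have h3 : Real.exp (μ * (ρ + c * t)) * ∫ x, D 0 x
        = Real.exp (c * μ * t) * (Real.exp (μ * ρ) * ∫ x, D 0 x) := by
      rw [← mul_assoc, ← Real.exp_add]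
      congr 2
      ring
    rw [h3]
    have h4 := mul_le_mul_of_nonneg_left h2 (Real.exp_pos (c * μ * t)).le
    simp only [hD] at h4 ⊢
    linarith
  have hall : ∀ᵐ x : Plane, ρ + c * t < ‖x‖ → D t x = 0 := by
    filter_upwards [ae_all_iff.2 fun n : ℕ => key (1 / (n + 1 : ℝ)) (by positivity)] with x hx hxr
    have hr : ρ + c * t < Real.sqrt (A ^ 2 + ‖x‖ ^ 2) :=
      hxr.trans_le (Real.le_sqrt_of_sq_le (by nlinarith [sq_nonneg A]))
    have hseq : Tendsto (fun n : ℕ => (1 / (n + 1 : ℝ))) atTop (𝓝[>] 0) :=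
      tendsto_nhdsWithin_iff.2 ⟨tendsto_one_div_add_atTop_nhds_zero_nat,
        Eventually.of_forall fun n => Set.mem_Ioi.2 (by positivity)⟩
    obtain ⟨n, hn⟩ := (((tendsto_boundedNorm (A := A) x).comp hseq).eventually_const_lt hr).exists
    exact hx n hn
  constructor
  · filter_upwards [hall] with x hx hxr
    have := hx hxr
    have h2 := mul_nonneg (hK0 x) (sq_nonneg ‖g t x‖)
    have h3 : p t x ^ 2 = 0 := le_antisymm (by simp only [hD] at this; linarith) (sq_nonneg _)
    exact pow_eq_zero_iff two_ne_zero |>.1 h3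
  · filter_upwards [hall] with x hx hxr
    have := hx hxr
    have h2 := mul_le_mul_of_nonneg_right (hK1 x) (sq_nonneg ‖g t x‖)
    have h3 : km * ‖g t x‖ ^ 2 ≤ 0 := by
      simp only [hD] at this
      linarith [sq_nonneg (p t x)]
    have h4 : ‖g t x‖ ^ 2 = 0 := le_antisymm (by nlinarith) (sq_nonneg _)
    exact norm_eq_zero.1 (pow_eq_zero_iff two_ne_zero |>.1 h4)

theorem IsMildSolution.supportedIn_of_velocity {K : Plane → ℝ} {u p : ℝ → L2 ℝ} {g : ℝ → L2 Plane}
    (hu : IsMildSolution K u p g) {ρ c : ℝ} (hc : 0 ≤ c) (hu0 : SupportedIn ρ (u 0))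
    (hp : ∀ t, 0 ≤ t → SupportedIn (ρ + c * t) (p t)) {t : ℝ} (ht : 0 ≤ t) :
    SupportedIn (ρ + c * t) (u t) := by
  have h1 := hu.sub_eq_integral 0 t le_rfl ht
  rw [eq_add_of_sub_eq h1]
  refine (SupportedIn.intervalIntegral hu.continuous_p ht fun s hs => ?_).add
    (hu0.mono (by nlinarith))
  exact (hp s hs.1).mono (by nlinarith [hs.2])

/-! ### Growth of the `L²` norm. -/

namespace IsMildSolution

variable {K : Plane → ℝ} {u p : ℝ → L2 ℝ} {g : ℝ → L2 Plane}

theorem hasDerivWithinAt (hu : IsMildSolution K u p g) {t : ℝ} (ht : 0 ≤ t) :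
    HasDerivWithinAt u (p t) (Set.Ici t) t := by
  have h1 : HasDerivAt (fun s => u 0 + ∫ r in (0)..s, p r) (p t) t :=
    (hu.continuous_p.integral_hasStrictDerivAt 0 t).hasDerivAt.const_add _
  have h2 : ∀ s, 0 ≤ s → u s = u 0 + ∫ r in (0)..s, p r := fun s hs => by
    rw [← hu.sub_eq_integral 0 s le_rfl hs]
    abel
  exact h1.hasDerivWithinAt.congr (fun s hs => h2 s (ht.trans hs)) (h2 t ht)

/-- The energy identity for the time primitive `∫₀ᵗ u`. -/
theorem primitive_energy (hu : IsMildSolution K u p g)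
    (hK : MemLp K ⊤ (volume : Measure Plane)) {t : ℝ} (ht : 0 ≤ t) :
    1 / 2 * (‖u t‖ ^ 2 + inner ℝ (∫ s in (0)..t, g s) (scal Plane K (∫ s in (0)..t, g s)))
      = 1 / 2 * ‖u 0‖ ^ 2 + inner ℝ (p 0) (∫ s in (0)..t, u s) := by
  set V : ℝ → L2 ℝ := fun t => ∫ s in (0)..t, u s with hV
  set W : ℝ → L2 Plane := fun t => ∫ s in (0)..t, g s with hW
  have dV : ∀ t, HasDerivAt V (u t) t := fun t =>
    (hu.continuous_u.integral_hasStrictDerivAt 0 t).hasDerivAt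
  have dW : ∀ t, HasDerivAt W (g t) t := fun t =>
    (hu.continuous_g.integral_hasStrictDerivAt 0 t).hasDerivAt
  set Φ : ℝ → ℝ := fun s => 1 / 2 * (inner ℝ (u s) (u s) + inner ℝ (W s) (scal Plane K (W s)))
    - inner ℝ (p 0) (V s) with hΦ
  have dΦ : ∀ s, 0 ≤ s → HasDerivWithinAt Φ 0 (Set.Ici s) s := by
    intro s hs
    have h1 := hu.hasDerivWithinAt hs
    have h2 := (dW s).hasDerivWithinAt (s := Set.Ici s)
    have h3 := (scal Plane K).hasFDerivAt.comp_hasDerivWithinAt s h2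
    have h4 := (hasDerivWithinAt_const s (Set.Ici s) (p 0)).inner ℝ
      ((dV s).hasDerivWithinAt (s := Set.Ici s))
    refine ((((h1.inner ℝ h1).add (h2.inner ℝ h3)).const_mul (1 / 2)).sub h4).congr_deriv ?_
    -- Here `p s - p 0 = ∇ · (K W)` is the equation `v_tt - ∇ · (K ∇v) = u₁` for `v = V`; pairing it
    -- with `v_t = u` makes `Φ` constant.
    have h5 := (hu.weakDivergence 0 s le_rfl hs).inner_eq (hu.weakGradient s)
    rw [inner_sub_left] at h5
    simp only [inner_zero_left, Function.comp]
    rw [inner_scal_left hK] at h5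
    have h6 : inner ℝ (g s) (scal Plane K (W s)) = inner ℝ (W s) (scal Plane K (g s)) := by
      rw [← inner_scal_left hK, real_inner_comm]
    rw [h6, real_inner_comm (p s) (u s)]
    change inner ℝ (p s) (u s) - inner ℝ (p 0) (u s) = -inner ℝ (W s) (scal Plane K (g s)) at h5
    linarith
  have hc : Continuous Φ := by
    have cV : Continuous V := continuous_iff_continuousAt.2 fun t => (dV t).continuousAt
    have cW : Continuous W := continuous_iff_continuousAt.2 fun t => (dW t).continuousAt
    exact (continuous_const.mul ((hu.continuous_u.inner hu.continuous_u).add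
      (cW.inner ((scal Plane K).continuous.comp cW)))).sub (continuous_const.inner cV)
  have := constant_of_has_deriv_right_zero (f := Φ) (a := 0) (b := t) hc.continuousOn
    (fun s hs => dΦ s hs.1) t (Set.right_mem_Icc.2 ht)
  simp only [hΦ, hV, hW, intervalIntegral.integral_same, inner_zero_left, inner_zero_right,
    real_inner_self_eq_norm_sq, add_zero, sub_zero] at this
  linarith

/-- Logarithmic growth of the `L²` norm. -/
theorem norm_sq_le (hu : IsMildSolution K u p g) (hK : MemLp K ⊤ (volume : Measure Plane))
    {km : ℝ} (hkm : 0 < km) (hK1 : ∀ x, km ≤ K x) {u₁ : Plane → ℝ} (hu₁ : IsTestFunction u₁)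
    (hp0 : p 0 = hu₁.toL2) {ρ c : ℝ} (hρ : 0 ≤ ρ) (hc : 0 ≤ c)
    (hsupp : ∀ t, 0 ≤ t → SupportedIn (ρ + c * t) (u t)) :
    ∃ C : ℝ, 0 ≤ C ∧ ∀ t, 0 ≤ t →
      ‖u t‖ ^ 2 ≤ C * (1 + Real.log (1 + (2 * (ρ + c * t + 1)) ^ 2)) := by
  have hm : ContDiff ℝ ∞ fun x : Plane => 1 + ‖x‖ ^ 2 := contDiff_const.add (contDiff_norm_sq ℝ)
  -- The weight `(1 + |x|²)⁻¹` of the Hardy inequality is paid for by `u₁`, whose support is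
  -- compact.
  have hb := hu₁.mul_left hm
  set B := ‖hb.toL2‖ with hB
  refine ⟨‖u 0‖ ^ 2 + B ^ 2 / (4 * km), by positivity, fun t ht => ?_⟩
  set L := 1 + Real.log (1 + (2 * (ρ + c * t + 1)) ^ 2) with hL
  have hL1 : 1 ≤ L := by
    have : 0 ≤ Real.log (1 + (2 * (ρ + c * t + 1)) ^ 2) :=
      Real.log_nonneg (by nlinarith [sq_nonneg (2 * (ρ + c * t + 1))])
    linarith
  set v : L2 ℝ := ∫ s in (0)..t, u s with hv
  set w : L2 Plane := ∫ s in (0)..t, g s with hw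
  have hgrad : HasWeakGradient v w :=
    HasWeakGradient.intervalIntegral hu.continuous_u hu.continuous_g hu.weakGradient 0 t
  have hvs : SupportedIn (ρ + c * t) v := SupportedIn.intervalIntegral hu.continuous_u ht
    fun s hs => (hsupp s hs.1).mono (by nlinarith [hs.2])
  have h1 := hgrad.hardy (by positivity) hvs
  have h2 := hu.primitive_energy hK ht
  have h3 : inner ℝ (p 0) v = inner ℝ hb.toL2 (scal ℝ (fun x => (1 + ‖x‖ ^ 2)⁻¹) v) := by
    rw [hp0, inner_scal memLp_inv_one_add_norm_sq, inner_L2]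
    refine integral_congr_ae ?_
    filter_upwards [hu₁.coeFn_toL2, hb.coeFn_toL2] with x h4 h5
    rw [h4, h5]
    have : (1 : ℝ) + ‖x‖ ^ 2 ≠ 0 := by positivity
    simp only [RCLike.inner_apply, conj_trivial]
    field_simp
  have h4 : km * ‖w‖ ^ 2 ≤ inner ℝ w (scal Plane K w) := by
    rw [inner_scal hK, norm_sq_L2, ← integral_const_mul]
    refine integral_mono ((integrable_norm_sq_L2 w).const_mul _) (integrable_mul_inner hK w w)
      fun x => ?_
    simp only [real_inner_self_eq_norm_sq]
    exact mul_le_mul_of_nonneg_right (hK1 x) (sq_nonneg _)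
  set z := ‖scal ℝ (fun x : Plane => (1 + ‖x‖ ^ 2)⁻¹) v‖ with hz
  have h5 : inner ℝ (p 0) v ≤ B * z := by
    rw [h3]
    exact real_inner_le_norm _ _
  -- Young's inequality, balanced with the Hardy constant so that `‖w‖²` appears with exactly the
  -- coefficient `km / 2` found in the energy.
  have h6 : B * z ≤ km / 2 * ‖w‖ ^ 2 + B ^ 2 / (8 * km) * L := by
    have hLpos : 0 < L := by linarith
    have h7 : 2 * km / L * z ^ 2 ≤ km / 2 * ‖w‖ ^ 2 := by
      calc 2 * km / L * z ^ 2 ≤ 2 * km / L * (L / 4 * ‖w‖ ^ 2) := by gcongr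
        _ = km / 2 * ‖w‖ ^ 2 := by
          field_simp
          ring
    have h8 : B * z ≤ 2 * km / L * z ^ 2 + B ^ 2 / (8 * km) * L := by
      have h9 : 2 * km / L * z ^ 2 + B ^ 2 / (8 * km) * L - B * z
          = (4 * km * z - B * L) ^ 2 / (8 * km * L) := by
        field_simp
        ring
      have h10 : 0 ≤ (4 * km * z - B * L) ^ 2 / (8 * km * L) := by positivity
      linarith
    linarith
  have h11 : B ^ 2 / (8 * km) * L = 1 / 2 * (B ^ 2 / (4 * km) * L) := by
    field_simp
    ring
  have h12 : ‖u 0‖ ^ 2 ≤ ‖u 0‖ ^ 2 * L := le_mul_of_one_le_right (sq_nonneg _) hL1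
  rw [add_mul]
  linarith

end IsMildSolution

/-! ### The Morawetz estimate. -/

theorem gradient_eq_zero_of_eq_one {χ : Plane → ℝ} {M : ℝ}
    (h : ∀ x : Plane, ‖x‖ ≤ M + 1 → χ x = 1) {x : Plane} (hx : ‖x‖ ≤ M) : gradient χ x = 0 := by
  have : χ =ᶠ[𝓝 x] fun _ => 1 := by
    have : Metric.ball (0 : Plane) (M + 1) ∈ 𝓝 x :=
      Metric.isOpen_ball.mem_nhds (by rw [mem_ball_zero_iff]; linarith)
    filter_upwards [this] with y hy
    exact h y (mem_ball_zero_iff.1 hy).le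
  rw [this.gradient_eq, gradient_fun_const]

theorem IsTestFunction.memLp_smul_id {χ : Plane → ℝ} (hχ : IsTestFunction χ) :
    MemLp (fun x : Plane => χ x • x) ⊤ (volume : Measure Plane) :=
  (hχ.1.continuous.smul continuous_id).memLp_of_hasCompactSupport hχ.2.smul_right

theorem coeFn_dot_of_supportedIn {χ : Plane → ℝ} (hχ : IsTestFunction χ) {M : ℝ}
    (h : ∀ x : Plane, ‖x‖ ≤ M + 1 → χ x = 1) {g : L2 Plane} (hg : SupportedIn M g) :
    dot (fun x => χ x • x) g =ᵐ[volume] fun x => inner ℝ x (g x) := by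
  filter_upwards [coeFn_dot hχ.memLp_smul_id g, hg] with x h1 h2
  rw [h1]
  by_cases hx : ‖x‖ ≤ M
  · rw [h x (by linarith), one_smul]
  · rw [h2 (not_le.1 hx), inner_zero_right, inner_zero_right]

/-- `∫ p x · ∇p = -(n / 2) ‖p‖²` with `n = 2`; the cutoff `χ` is invisible on the support of `p`. -/
theorem inner_dot_gradient_of_supportedIn {χ : Plane → ℝ} (hχ : IsTestFunction χ) {M : ℝ}
    (h : ∀ x : Plane, ‖x‖ ≤ M + 1 → χ x = 1) {p : L2 ℝ} {q : L2 Plane}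
    (hw : HasWeakGradient p q) (hp : SupportedIn M p) :
    inner ℝ p (dot (fun x => χ x • x) q) = -‖p‖ ^ 2 := by
  have h1 := hw.integral_mul_radial hχ
  have h2 : ∫ x, (2 * χ x + inner ℝ x (gradient χ x)) * p x ^ 2 = ∫ x, 2 * ‖p x‖ ^ 2 := by
    refine integral_congr_ae ?_
    filter_upwards [hp] with x hx
    rw [Real.norm_eq_abs, sq_abs]
    by_cases hxM : ‖x‖ ≤ M
    · rw [h x (by linarith), gradient_eq_zero_of_eq_one h hxM, inner_zero_right]
      ring
    · rw [hx (not_le.1 hxM)]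
      ring
  rw [h2, integral_const_mul, ← norm_sq_L2] at h1
  have h3 : inner ℝ p (dot (fun x => χ x • x) q) = ∫ x, χ x * (p x * inner ℝ x (q x)) := by
    rw [inner_dot hχ.memLp_smul_id]
    refine integral_congr_ae (Eventually.of_forall fun x => ?_)
    simp only [inner_smul_left, conj_trivial]
    ring
  rw [h3]
  linarith

theorem weightedEnergy_one (K : Plane → ℝ) (p : L2 ℝ) (g : L2 Plane) :
    weightedEnergy K (fun _ => 1) p g = 1 / 2 * (‖p‖ ^ 2 + inner ℝ g (scal Plane K g)) := by
  rw [weightedEnergy, scal_one, real_inner_self_eq_norm_sq]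
  simp only [one_mul]

/-- The Morawetz-type estimate for regular solutions, with multiplier
`t u_t + x ⬝ ∇u + u / 2`. -/
theorem IsRegularSolution.morawetz {K : Plane → ℝ} {u p a : ℝ → L2 ℝ} {g q : ℝ → L2 Plane}
    (h : IsRegularSolution K u p a g q) (hK : MemLp K ⊤ (volume : Measure Plane))
    (hK0 : ∀ x, 0 ≤ K x) (hKr : ∀ c : ℝ, 0 < c → c ≤ 1 → ∀ x, K x ≤ K (c • x))
    {M T : ℝ} (hM : 0 < M) (hT : 0 ≤ T) (su : ∀ t ∈ Set.Icc 0 T, SupportedIn M (u t))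
    (sp : ∀ t ∈ Set.Icc 0 T, SupportedIn M (p t)) (sg : ∀ t ∈ Set.Icc 0 T, SupportedIn M (g t))
    {χ : Plane → ℝ} (hχ : IsTestFunction χ) (hχ1 : ∀ x : Plane, ‖x‖ ≤ M + 1 → χ x = 1) :
    T * weightedEnergy K (fun _ => 1) (p T) (g T)
        + inner ℝ (p T) (dot (fun x => χ x • x) (g T)) + 1 / 2 * inner ℝ (u T) (p T)
      ≤ inner ℝ (p 0) (dot (fun x => χ x • x) (g 0)) + 1 / 2 * inner ℝ (u 0) (p 0) := by
  set X := dot fun x => χ x • x with hX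
  set e : ℝ → ℝ := fun t => weightedEnergy K (fun _ => 1) (p t) (g t) with he
  set G : ℝ → ℝ := fun t => t * e t + inner ℝ (p t) (X (g t)) + 1 / 2 * inner ℝ (u t) (p t) with hG
  have hg1 : gradient (fun _ : Plane => (1 : ℝ)) = fun _ => 0 := gradient_fun_const' 1
  have hz : ∀ f : L2 ℝ, vec (fun _ => (0 : Plane)) f = 0 := fun f => by
    have := norm_vec_le (memLp_const_top (0 : Plane)) (C := 0) (fun _ => by simp) f
    rw [zero_mul] at this
    exact norm_le_zero_iff.1 this
  have dG : ∀ t, 0 < t → HasDerivAt G (1 * e t + t * 0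
      + (inner ℝ (p t) (X (q t)) + inner ℝ (a t) (X (g t)))
      + 1 / 2 * (inner ℝ (u t) (a t) + inner ℝ (p t) (p t))) t := by
    intro t ht
    have de := h.hasDerivAt_weightedEnergy hK (w := fun _ => 1) contDiff_const memLp_top_one
      (by rw [hg1]; exact memLp_const_top (0 : Plane)) ht
    rw [hg1, hz, inner_zero_right, neg_zero] at de
    exact (((hasDerivAt_id t).mul de).add ((h.deriv_p t ht).inner ℝ
      (X.hasFDerivAt.comp_hasDerivAt t (h.deriv_g t ht)))).add
      (((h.deriv_u t ht).inner ℝ (h.deriv_p t ht)).const_mul _)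
  have cG : Continuous G := by
    have ce : Continuous e := continuous_iff_continuousAt.2 fun s =>
      Filter.Tendsto.weightedEnergy h.continuous_p.continuousAt h.continuous_g.continuousAt
    exact ((continuous_id.mul ce).add (h.continuous_p.inner (X.continuous.comp h.continuous_g))).add
      (continuous_const.mul (h.continuous_u.inner h.continuous_p))
  have hanti : AntitoneOn G (Set.Icc 0 T) := by
    refine antitoneOn_of_deriv_nonpos (convex_Icc 0 T) cG.continuousOn ?_ ?_
    · intro t ht
      rw [interior_Icc] at ht
      exact (dG t ht.1).differentiableAt.differentiableWithinAt
    · intro t ht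
      rw [interior_Icc] at ht
      have htI := Set.Ioo_subset_Icc_self ht
      rw [(dG t ht.1).deriv]
      -- The derivative of `G` is the energy, minus `‖p‖²`, plus the Pohozaev term, plus half of
      -- `‖p‖² - ∫ K |g|²` (`e1`, `e3`). All quadratic terms cancel and the nonpositive Pohozaev
      -- term `e2` remains.
      have e1 := inner_dot_gradient_of_supportedIn hχ hχ1 (h.weakGradient_p t ht.1) (sp t htI)
      have e2 := (h.weakDivergence t ht.1).inner_radial_nonpos hK hK0 hKr (h.weakGradient_u t ht.1)
        hM (su t htI) (sg t htI) (coeFn_dot_of_supportedIn hχ hχ1 (sg t htI))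
      have e3 := (h.weakDivergence t ht.1).inner_eq (h.weakGradient_u t ht.1)
      rw [inner_scal_left hK, real_inner_comm] at e3
      rw [← hX] at e1 e2
      rw [e1, e3, real_inner_self_eq_norm_sq]
      simp only [he, weightedEnergy_one]
      linarith
  have := hanti (Set.left_mem_Icc.2 hT) (Set.right_mem_Icc.2 hT) hT
  simpa only [hG, zero_mul, zero_add] using this

theorem integrable_mul_inner_id_of_supportedIn {p : L2 ℝ} {g : L2 Plane} {M : ℝ} (hM : 0 < M)
    (hg : SupportedIn M g) : Integrable fun x => p x * inner ℝ x (g x) := by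
  obtain ⟨C, -, hC⟩ := exists_cutoff
  obtain ⟨χ, h1, -, h3, -, -⟩ := hC (M + 1) (by linarith)
  refine (integrable_inner_L2 p (dot (fun x => χ x • x) g)).congr ?_
  filter_upwards [coeFn_dot_of_supportedIn h1 h3 hg] with x hx
  rw [hx]
  simp [mul_comm]

theorem inner_dot_eq_of_supportedIn {χ : Plane → ℝ} (hχ : IsTestFunction χ) {M : ℝ}
    (h : ∀ x : Plane, ‖x‖ ≤ M + 1 → χ x = 1) (p : L2 ℝ) {g : L2 Plane} (hg : SupportedIn M g) :
    inner ℝ p (dot (fun x => χ x • x) g) = ∫ x, p x * inner ℝ x (g x) := by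
  rw [inner_L2]
  refine integral_congr_ae ?_
  filter_upwards [coeFn_dot_of_supportedIn hχ h hg] with x hx
  rw [hx]
  simp [mul_comm]

theorem IsMildSolution.morawetz {K : Plane → ℝ} {u p : ℝ → L2 ℝ} {g : ℝ → L2 Plane}
    (hu : IsMildSolution K u p g) (hK : MemLp K ⊤ (volume : Measure Plane))
    (hK0 : ∀ x, 0 ≤ K x) (hKr : ∀ c : ℝ, 0 < c → c ≤ 1 → ∀ x, K x ≤ K (c • x))
    {ρ c : ℝ} (hρ : 0 ≤ ρ) (hc : 0 < c) (su : ∀ t, 0 ≤ t → SupportedIn (ρ + c * t) (u t))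
    (sp : ∀ t, 0 ≤ t → SupportedIn (ρ + c * t) (p t))
    (sg : ∀ t, 0 ≤ t → SupportedIn (ρ + c * t) (g t)) {T : ℝ} (hT : 0 ≤ T) :
    T * weightedEnergy K (fun _ => 1) (p T) (g T)
        + (∫ x, p T x * inner ℝ x (g T x)) + 1 / 2 * inner ℝ (u T) (p T)
      ≤ (∫ x, p 0 x * inner ℝ x (g 0 x)) + 1 / 2 * inner ℝ (u 0) (p 0) := by
  -- Averages over `[t, t + h]` with `h < 1` look ahead at most to time `T + 1`.
  set M := ρ + c * (T + 1) with hM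
  have hM0 : 0 < M := by positivity
  have hle : ∀ t ∈ Set.Icc 0 (T + 1), ρ + c * t ≤ M := fun t ht => by
    rw [hM]
    have := ht.2
    gcongr
  have hst : ∀ {E : Type} [NormedAddCommGroup E] [NormedSpace ℝ E] [CompleteSpace E]
      {F : ℝ → L2 E}, Continuous F → (∀ t, 0 ≤ t → SupportedIn (ρ + c * t) (F t)) →
      ∀ h ∈ Set.Ioo (0 : ℝ) 1, ∀ t ∈ Set.Icc 0 T, SupportedIn M (steklov h F t) := by
    intro E _ _ _ F hF hs h hh t ht
    refine SupportedIn.steklov hF hh.1.le fun s hsI => ?_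
    have hs0 : 0 ≤ s := ht.1.trans hsI.1
    exact (hs s hs0).mono (hle s ⟨hs0, by linarith [hsI.2, hh.2, ht.2]⟩)
  obtain ⟨C, -, hC⟩ := exists_cutoff
  obtain ⟨χ, h1, -, h3, -, -⟩ := hC (M + 1) (by linarith)
  have sgT : SupportedIn M (g T) := (sg T hT).mono (hle T ⟨hT, by linarith⟩)
  have sg0 : SupportedIn M (g 0) := (sg 0 le_rfl).mono (hle 0 ⟨le_rfl, by linarith⟩)
  rw [← inner_dot_eq_of_supportedIn h1 h3 (p T) sgT, ← inner_dot_eq_of_supportedIn h1 h3 (p 0) sg0]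
  set X := dot fun x => χ x • x with hX
  have tu := tendsto_steklov hu.continuous_u
  have tp := tendsto_steklov hu.continuous_p
  have tg := tendsto_steklov hu.continuous_g
  refine le_of_tendsto_of_tendsto
    (((((tp T).weightedEnergy (K := K) (w := fun _ => 1) (tg T)).const_mul T).add
      ((tp T).inner ((X.continuous.tendsto _).comp (tg T)))).add
      (((tu T).inner (tp T)).const_mul (1 / 2)))
    (((tp 0).inner ((X.continuous.tendsto _).comp (tg 0))).add
      (((tu 0).inner (tp 0)).const_mul (1 / 2))) ?_
  filter_upwards [Ioo_mem_nhdsGT (zero_lt_one' ℝ)] with h hh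
  exact (hu.regular hh.1).morawetz hK hK0 hKr hM0 hT (hst hu.continuous_u su h hh)
    (hst hu.continuous_p sp h hh) (hst hu.continuous_g sg h hh) h1 h3

/-! ### Localization of the energy and conclusion. -/

theorem HasWeakGradient.unique {f : L2 ℝ} {g g' : L2 Plane} (h : HasWeakGradient f g)
    (h' : HasWeakGradient f g') : g = g' := by
  refine Lp.ext (ae_eq_of_integral_contDiff_smul_eq
    ((Lp.memLp g).locallyIntegrable (by norm_num)) ((Lp.memLp g').locallyIntegrable (by norm_num))
    fun φ h1 h2 => ?_)
  exact neg_injective ((h φ ⟨h1, h2⟩).symm.trans (h' φ ⟨h1, h2⟩))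

theorem IsTestFunction.exists_supportedIn {φ : Plane → ℝ} (hφ : IsTestFunction φ) :
    ∃ R : ℝ, SupportedIn R hφ.toL2 ∧ SupportedIn R hφ.gradL2 := by
  obtain ⟨R, hR⟩ := hφ.2.isCompact.isBounded.subset_closedBall (0 : Plane)
  have hz : ∀ x : Plane, R < ‖x‖ → x ∉ tsupport φ := by
    intro x hx hmem
    have := hR hmem
    rw [mem_closedBall_zero_iff] at this
    linarith
  refine ⟨R, ?_, ?_⟩
  · filter_upwards [hφ.coeFn_toL2] with x hx hxR
    rw [hx]
    exact image_eq_zero_of_notMem_tsupport (hz x hxR)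
  · filter_upwards [hφ.coeFn_gradL2] with x hx hxR
    rw [hx, gradient, image_eq_zero_of_notMem_tsupport fun h => hz x hxR (tsupport_fderiv_subset ℝ h),
      map_zero]

/-- A `C¹` function with `x ⬝ ∇K ≤ 0` is radially nonincreasing. -/
theorem le_smul_of_inner_gradient_nonpos {K : Plane → ℝ} (hK : Differentiable ℝ K)
    (h : ∀ x, inner ℝ x (gradient K x) ≤ 0) {c : ℝ} (hc : 0 < c) (hc1 : c ≤ 1) (x : Plane) :
    K x ≤ K (c • x) := by
  have hd : ∀ s : ℝ, HasDerivAt (fun s : ℝ => K (s • x)) (inner ℝ x (gradient K (s • x))) s := by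
    intro s
    have h1 : HasDerivAt (fun s : ℝ => s • x) ((1 : ℝ) • x) s := (hasDerivAt_id s).smul_const x
    have := (hK (s • x)).hasFDerivAt.comp_hasDerivAt s h1
    rw [one_smul] at this
    rw [inner_gradient_right, conj_trivial]
    exact this
  have hanti : AntitoneOn (fun s : ℝ => K (s • x)) (Set.Icc c 1) := by
    refine antitoneOn_of_deriv_nonpos (convex_Icc c 1)
      (fun s _ => (hd s).continuousAt.continuousWithinAt)
      (fun s _ => (hd s).differentiableAt.differentiableWithinAt) fun s hs => ?_
    rw [interior_Icc] at hs
    have hs0 : 0 < s := hc.trans hs.1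
    rw [(hd s).deriv]
    have := h (s • x)
    rw [inner_smul_left, conj_trivial] at this
    exact nonpos_of_mul_nonpos_right this hs0
  have := hanti (Set.left_mem_Icc.2 hc1) (Set.right_mem_Icc.2 hc1) hc1
  simpa only [one_smul] using this

/-- Here `r = |x|` and `ip` stands for `x · ∇u`. Both parts use `|p| w ≤ (p² + k w²) / (2 s)` for
`s² ≤ k`: with `s = √km` near the origin, and with the exact speed `s = c` far out, where `r / c ≤ t
+ ρ / c` lets the term `t / 2` absorb all but a bounded part. -/
theorem localEnergy_pointwise {r R ρ c t km k p w ip : ℝ} (hR : 0 ≤ R) (hρ : 0 ≤ ρ)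
    (hc : 0 < c) (ht : 0 ≤ t) (hkm : 0 < km) (hk : km ≤ k) (hip : |ip| ≤ r * w) (hw : 0 ≤ w) :
    (r ≤ R → (t / 2 - R / (2 * Real.sqrt km)) * (p ^ 2 + k * w ^ 2)
        - ρ / (2 * c) * (p ^ 2 + k * w ^ 2) ≤ t / 2 * (p ^ 2 + k * w ^ 2) + p * ip) ∧
    (k = c ^ 2 → r ≤ ρ + c * t → -(ρ / (2 * c)) * (p ^ 2 + k * w ^ 2)
        ≤ t / 2 * (p ^ 2 + k * w ^ 2) + p * ip) := by
  have hD : 0 ≤ p ^ 2 + k * w ^ 2 := by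
    have : 0 ≤ k := hkm.le.trans hk
    positivity
  have hb : -(|p| * (r * w)) ≤ p * ip := by
    have h1 : |p * ip| ≤ |p| * (r * w) := by
      rw [abs_mul]
      exact mul_le_mul_of_nonneg_left hip (abs_nonneg p)
    exact neg_le_of_abs_le h1
  have gen : ∀ s : ℝ, 0 < s → s ^ 2 ≤ k → |p| * w ≤ 1 / (2 * s) * (p ^ 2 + k * w ^ 2) := by
    intro s hs hsk
    rw [one_div, inv_mul_eq_div, le_div_iff₀ (by positivity)]
    nlinarith [sq_nonneg (|p| - s * w), sq_abs p, mul_le_mul_of_nonneg_right hsk (sq_nonneg w)]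
  constructor
  · intro hrR
    have hs := Real.sqrt_pos.2 hkm
    have h1 := gen _ hs (by rw [Real.sq_sqrt hkm.le]; exact hk)
    have h2 : |p| * (r * w) ≤ R / (2 * Real.sqrt km) * (p ^ 2 + k * w ^ 2) := by
      calc |p| * (r * w) = r * (|p| * w) := by ring
        _ ≤ R * (1 / (2 * Real.sqrt km) * (p ^ 2 + k * w ^ 2)) := by gcongr
        _ = _ := by ring
    have h3 : 0 ≤ ρ / (2 * c) * (p ^ 2 + k * w ^ 2) := by positivity
    nlinarith
  · intro hkc hrt
    have h1 := gen c hc hkc.ge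
    have h2 : |p| * (r * w) ≤ (ρ / (2 * c) + t / 2) * (p ^ 2 + k * w ^ 2) := by
      calc |p| * (r * w) = r * (|p| * w) := by ring
        _ ≤ (ρ + c * t) * (1 / (2 * c) * (p ^ 2 + k * w ^ 2)) := by gcongr
        _ = _ := by
          field_simp
    nlinarith

theorem isBigO_log_growth {e : ℝ → ℝ} {a C₁ C₂ ρ c : ℝ} (hC₁ : 0 ≤ C₁) (hC₂ : 0 ≤ C₂) (hρ : 0 ≤ ρ)
    (hc : 0 ≤ c) (he : ∀ᶠ t in atTop, 0 ≤ e t)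
    (h : ∀ᶠ t in atTop, (t - a) * e t ≤
      C₁ + C₂ * Real.sqrt (1 + Real.log (1 + (2 * (ρ + c * t + 1)) ^ 2))) :
    e =O[atTop] fun t : ℝ => t⁻¹ * Real.sqrt (Real.log t) := by
  set b := 1 + (2 * (ρ + c + 1)) ^ 2 with hb
  set S := Real.sqrt (3 + Real.log b) with hS
  have hb1 : 1 ≤ b := by
    rw [hb]
    nlinarith [sq_nonneg (2 * (ρ + c + 1))]
  have hlb : 0 ≤ Real.log b := Real.log_nonneg hb1
  refine IsBigO.of_bound (2 * (C₁ + C₂ * S)) ?_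
  -- From `t ≥ e` comes `log t ≥ 1`, so constants are absorbed in the logarithm; `t ≥ 2 a` gives `t
  -- - a ≥ t / 2`.
  filter_upwards [he, h, eventually_ge_atTop (Real.exp 1), eventually_ge_atTop (2 * a)]
    with t h1 h2 h3 h4
  have ht1 : 1 ≤ t := by
    have := Real.add_one_le_exp (1 : ℝ)
    linarith
  have ht0 : 0 < t := by linarith
  have hlog : 1 ≤ Real.log t := by rwa [Real.le_log_iff_exp_le ht0]
  have hlog' : 1 ≤ Real.sqrt (Real.log t) := Real.one_le_sqrt.2 hlog
  have h5 : Real.log (1 + (2 * (ρ + c * t + 1)) ^ 2) ≤ Real.log b + 2 * Real.log t := by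
    have h6 : Real.log b + 2 * Real.log t = Real.log (b * t ^ 2) := by
      rw [Real.log_mul (by positivity) (by positivity), Real.log_pow]
      norm_num
    rw [h6]
    refine Real.log_le_log (by positivity) ?_
    have h7 : ρ + c * t + 1 ≤ (ρ + c + 1) * t := by nlinarith
    have h8 : (2 * (ρ + c * t + 1)) ^ 2 ≤ (2 * ((ρ + c + 1) * t)) ^ 2 := by gcongr
    have h9 : 1 ≤ t ^ 2 := one_le_pow₀ ht1
    rw [hb]
    nlinarith
  have h6 : Real.sqrt (1 + Real.log (1 + (2 * (ρ + c * t + 1)) ^ 2))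
      ≤ S * Real.sqrt (Real.log t) := by
    rw [hS, ← Real.sqrt_mul (by positivity)]
    refine Real.sqrt_le_sqrt ?_
    nlinarith
  have h7 : t / 2 * e t ≤ (C₁ + C₂ * S) * Real.sqrt (Real.log t) := by
    calc t / 2 * e t ≤ (t - a) * e t := mul_le_mul_of_nonneg_right (by linarith) h1
      _ ≤ C₁ + C₂ * Real.sqrt (1 + Real.log (1 + (2 * (ρ + c * t + 1)) ^ 2)) := h2
      _ ≤ C₁ * Real.sqrt (Real.log t) + C₂ * (S * Real.sqrt (Real.log t)) := by
        refine add_le_add (le_mul_of_one_le_right hC₁ hlog') ?_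
        gcongr
      _ = _ := by ring
  rw [Real.norm_of_nonneg h1, Real.norm_of_nonneg (by positivity)]
  have h8 : e t = t⁻¹ * (2 * (t / 2 * e t)) := by
    field_simp
  rw [h8]
  calc t⁻¹ * (2 * (t / 2 * e t)) ≤ t⁻¹ * (2 * ((C₁ + C₂ * S) * Real.sqrt (Real.log t))) := by gcongr
    _ = _ := by ring

/-- Integrates the pointwise bounds over three regions: the ball of radius `R`, the rest of the
propagation ball, and its exterior. In the exterior only `g` has to vanish, since the leftover terms
in `p²` have the right sign. -/
theorem localEnergy_le {K : Plane → ℝ} {km k₀ r₀ R ρ t : ℝ}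
    (hK : MemLp K ⊤ (volume : Measure Plane)) (hkm : 0 < km) (hK1 : ∀ x, km ≤ K x) (hk₀ : 0 < k₀)
    (hK3 : ∀ x : Plane, r₀ < ‖x‖ → K x = k₀) (hr₀ : 0 < r₀) (hR : r₀ < R) (hρ : 0 ≤ ρ)
    (ht : 0 ≤ t) {p : L2 ℝ} {g : L2 Plane}
    (sg : SupportedIn (ρ + Real.sqrt k₀ * t) g) :
    (t - R / Real.sqrt km) * localEnergy K R p g - ρ / Real.sqrt k₀ *
        weightedEnergy K (fun _ => 1) p g
      ≤ t * weightedEnergy K (fun _ => 1) p g + ∫ x, p x * inner ℝ x (g x) := by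
  set c := Real.sqrt k₀ with hc
  have hc0 : 0 < c := Real.sqrt_pos.2 hk₀
  set D : Plane → ℝ := fun x => p x ^ 2 + K x * ‖g x‖ ^ 2 with hD
  have hDi : Integrable D := by
    simpa only [one_mul] using integrable_energyDensity memLp_top_one hK p g
  have hball : MeasurableSet (Metric.closedBall (0 : Plane) R) :=
    Metric.isClosed_closedBall.measurableSet
  have hE : weightedEnergy K (fun _ => 1) p g = 1 / 2 * ∫ x, D x := by
    rw [weightedEnergy_eq memLp_top_one hK]
    simp only [one_mul, hD]
  have hEl : localEnergy K R p g
      = 1 / 2 * ∫ x, (Metric.closedBall (0 : Plane) R).indicator D x := by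
    rw [localEnergy, integral_indicator hball]
    simp only [sq_abs, hD]
  have hpx : Integrable fun x => p x * inner ℝ x (g x) :=
    integrable_mul_inner_id_of_supportedIn (M := ρ + c * t + 1) (by positivity)
      (sg.mono (by linarith))
  have main : ∫ x, ((t / 2 - R / (2 * Real.sqrt km)) *
        (Metric.closedBall (0 : Plane) R).indicator D x - ρ / (2 * c) * D x)
      ≤ ∫ x, (t / 2 * D x + p x * inner ℝ x (g x)) := by
    refine integral_mono_ae (((hDi.indicator hball).const_mul _).sub (hDi.const_mul _))
      ((hDi.const_mul _).add hpx) ?_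
    filter_upwards [sg] with x hx
    obtain ⟨h1, h2⟩ := localEnergy_pointwise (hr₀.trans hR).le hρ hc0 ht hkm (hK1 x)
      (p := p x) (abs_real_inner_le_norm x (g x)) (norm_nonneg (g x))
    by_cases hxR : ‖x‖ ≤ R
    · rw [Set.indicator_of_mem (mem_closedBall_zero_iff.2 hxR)]
      exact h1 hxR
    · rw [Set.indicator_of_notMem (by rwa [mem_closedBall_zero_iff]), mul_zero, zero_sub]
      by_cases hxt : ‖x‖ ≤ ρ + c * t
      · have := h2 (by rw [hK3 x (hR.trans (not_le.1 hxR)), hc, Real.sq_sqrt hk₀.le]) hxt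
        rw [← neg_mul]
        exact this
      · simp only [hD, hx (not_le.1 hxt), inner_zero_right, mul_zero, norm_zero, add_zero, ne_eq,
          OfNat.ofNat_ne_zero, not_false_eq_true, zero_pow]
        have h3 : 0 ≤ ρ / (2 * c) * p x ^ 2 := by positivity
        have h4 : 0 ≤ t / 2 * p x ^ 2 := by positivity
        linarith
  rw [integral_sub ((hDi.indicator hball).const_mul _) (hDi.const_mul _),
    integral_add (hDi.const_mul _) hpx, integral_const_mul, integral_const_mul,
    integral_const_mul] at main
  rw [hE, hEl]
  have e1 : ρ / c * (1 / 2 * ∫ x, D x) = ρ / (2 * c) * ∫ x, D x := by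
    field_simp
  have e2 : R / Real.sqrt km * (1 / 2) = R / (2 * Real.sqrt km) := by
    field_simp
  rw [e1, ← mul_assoc, sub_mul, e2]
  linarith

theorem theorem1p1
    (K u₀ u₁ : Plane → ℝ) (km k₀ r₀ R : ℝ)
    (hK : IsBC1 K)
    (hkm : 0 < km) (hK1 : ∀ x, km ≤ K x)
    (hK2 : ∀ x, inner ℝ x (gradient K x) ≤ 0)
    (hr₀ : 0 < r₀) (hK3 : ∀ x : Plane, r₀ < ‖x‖ → K x = k₀)
    (hu₀ : IsTestFunction u₀) (hu₁ : IsTestFunction u₁)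
    (hR : r₀ < R)
    (u ut : ℝ → Lp ℝ 2 (volume : Measure Plane))
    (gradu : ℝ → Lp Plane 2 (volume : Measure Plane))
    (hu : IsWaveSolution K u₀ u₁ u ut gradu) :
    (fun t : ℝ => localEnergy K R (ut t) (gradu t)) =O[atTop]
      (fun t : ℝ => t⁻¹ * Real.sqrt (Real.log t)) := by
  obtain ⟨hKd, ⟨C, hKC⟩, -⟩ := hK
  have hKb : MemLp K ⊤ (volume : Measure Plane) := memLp_top_of_continuous hKd.continuous hKC
  have hK0 : ∀ x, 0 ≤ K x := fun x => hkm.le.trans (hK1 x)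
  have hKr : ∀ c : ℝ, 0 < c → c ≤ 1 → ∀ x, K x ≤ K (c • x) := fun c hc hc1 x =>
    le_smul_of_inner_gradient_nonpos (hKd.differentiable (by simp)) hK2 hc hc1 x
  have hk₀ : 0 < k₀ := by
    obtain ⟨x, hx⟩ := NormedSpace.exists_lt_norm ℝ Plane r₀
    rw [← hK3 x hx]
    exact hkm.trans_le (hK1 x)
  have hm := hu.mild hKb
  have hpos : u 0 = hu₀.toL2 := Lp.ext (hu.init_pos.trans hu₀.coeFn_toL2.symm)
  have hvel : ut 0 = hu₁.toL2 := Lp.ext (hu.init_vel.trans hu₁.coeFn_toL2.symm)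
  -- The initial gradient is not part of the data; it is forced by uniqueness of weak gradients.
  have hgrad : gradu 0 = hu₀.gradL2 := by
    have h1 := hu.weakGradient 0 le_rfl
    rw [hpos] at h1
    exact h1.unique (HasWeakGradient.of_test hu₀)
  obtain ⟨R₁, s1, s2⟩ := hu₀.exists_supportedIn
  obtain ⟨R₂, s3, -⟩ := hu₁.exists_supportedIn
  obtain ⟨ρ, hρR, hρ, hprop⟩ := hm.finite_propagation (R₀ := max R₁ R₂) hKd.continuous hKC hkm hK1
    hk₀ hK3 (by simpa only [max_self, hvel] using s3.mono (le_max_right _ _))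
    (by simpa only [max_self, hgrad] using s2.mono (le_max_left _ _))
  have hc0 : 0 < Real.sqrt k₀ := Real.sqrt_pos.2 hk₀
  have hsu := fun t (ht : 0 ≤ t) => hm.supportedIn_of_velocity hc0.le
    (by simpa only [max_self, hpos] using s1.mono ((le_max_left _ _).trans hρR))
    (fun s hs => (hprop s hs).1) ht
  obtain ⟨B, hB0, hB⟩ := hm.norm_sq_le hKb hkm hK1 hu₁ (by simpa only [max_self] using hvel) hρ
    hc0.le hsu
  have hmor := fun t (ht : 0 ≤ t) => hm.morawetz hKb hK0 hKr hρ hc0 hsu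
    (fun s hs => (hprop s hs).1) (fun s hs => (hprop s hs).2) ht
  have hen := fun t (ht : 0 ≤ t) => hm.energy_le hKb hK0 ht
  simp only [max_self] at hmor hen
  set E₀ := weightedEnergy K (fun _ => 1) (ut 0) (gradu 0)
  set J := (∫ x, ut 0 x * inner ℝ x (gradu 0 x)) + 1 / 2 * inner ℝ (u 0) (ut 0)
  have hquad : ∀ g : L2 Plane, 0 ≤ inner ℝ g (scal Plane K g) := fun g => by
    rw [inner_scal hKb]
    exact integral_nonneg fun x => mul_nonneg (hK0 x) real_inner_self_nonneg
  have hE₀ : 0 ≤ E₀ := by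
    have := hquad (gradu 0)
    change 0 ≤ weightedEnergy K (fun _ => 1) (ut 0) (gradu 0)
    rw [weightedEnergy_one]
    positivity
  -- The constant `C₁` collects the initial Morawetz quantity and the energy lost to the offset `ρ`.
  -- The term with `C₂` bounds `(1/2) ‖u‖ ‖u_t‖`, with `‖u_t‖² ≤ 2 E₀` and the logarithmic growth of
  -- `‖u‖²`.
  refine isBigO_log_growth (a := R / Real.sqrt km) (C₁ := |J| + ρ / Real.sqrt k₀ * E₀)
    (C₂ := 1 / 2 * (Real.sqrt B * Real.sqrt (2 * E₀))) (ρ := ρ) (c := Real.sqrt k₀)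
    (by positivity) (by positivity) hρ hc0.le ?_ ?_
  · refine Eventually.of_forall fun t => ?_
    refine mul_nonneg (by norm_num) (integral_nonneg fun x => ?_)
    exact add_nonneg (sq_nonneg _) (mul_nonneg (hK0 x) (sq_nonneg _))
  · filter_upwards [eventually_ge_atTop 0] with t ht
    have h1 := hmor t ht
    have h2 := hen t ht
    have h3 := hB t ht
    have h4 := (hprop t ht).2
    rw [max_eq_left ht] at h1 h2 h3 h4
    have h5 := localEnergy_le hKb hkm hK1 hk₀ hK3 hr₀ hR hρ ht (p := ut t) h4
    have h6 : ρ / Real.sqrt k₀ * weightedEnergy K (fun _ => 1) (ut t) (gradu t)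
        ≤ ρ / Real.sqrt k₀ * E₀ := mul_le_mul_of_nonneg_left h2 (by positivity)
    have h7 : ‖ut t‖ ≤ Real.sqrt (2 * E₀) := by
      refine Real.le_sqrt_of_sq_le ?_
      rw [weightedEnergy_one] at h2
      have := hquad (gradu t)
      linarith
    have h8 := Real.le_sqrt_of_sq_le h3
    rw [Real.sqrt_mul hB0] at h8
    have h9 : -(‖u t‖ * ‖ut t‖) ≤ inner ℝ (u t) (ut t) :=
      neg_le_of_abs_le (abs_real_inner_le_norm _ _)
    have h10 := mul_le_mul h8 h7 (norm_nonneg _) (by positivity)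
    have h11 := le_abs_self J
    nlinarith
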